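/- Let $\beta,\lambda>0$, $\nu\in(0,1]$, let $N\ge 1$ be an integer, and put $\rho=\lambda/\beta^{\nu}$. Consider the following network. Webpages appear as a homogeneous Yule process of rate $\beta$ started from one page at time $0$ (while $k$ pages are present, the next page appears after an independent exponential time of rate $\beta k$). The numbers of in-links of the pages, counted from the creation of each page, are independent fractional nonlinear birth processes, independent of the creation times, with birth rates $\lambda_r=\lambda r(N-r)$ for $1\le r\le N$ (states above $N$ are never reached; set $\lambda_r=0$ for $r>N$): each is a counting process started from $1$ whose state probabilities $p_n(t)$ are locally absolutely continuous on $[0,\infty)$ and satisfy $$\frac{d^\nu p_n}{dt^\nu}(t)=-\lambda_n p_n(t)+\lambda_{n-1}p_{n-1}(t)\quad(n\ge1,\ t>0),\qquad p_0=0,\quad p_n(0)=\delta_{n,1},$$ where $\frac{d^\nu f}{dt^\nu}(t)=\frac1{\Gamma(1-\nu)}\int_0^t (t-s)^{-\nu}f'(s)\,ds$ is the Caputo derivative for $\nu\in(0,1)$ and the ordinary derivative for $\nu=1$. Let $S_t$ be the number of in-links at time $t$ of a webpage chosen uniformly at random among those present at time $t$. Write $b=\frac12\sqrt{N^2+4/\rho}$.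 Then $\lim_{t\to\infty}\mathbb P(S_t=n)=q_n$ for $1\le n\le N$, where $$q_n=\rho^{-1}\,\frac{\Gamma(n)\Gamma(N)}{\Gamma(N-n+1)}\,\frac{\Gamma(b+1-\frac N2)}{\Gamma(b+1-\frac N2+n)}\,\frac{\Gamma(b+\frac N2-n)}{\Gamma(b+\frac N2)},$$ and $\sum_{n=1}^N q_n=1$. Moreover, if $1-\frac N2-b$ is not a nonpositive integer, the limit also equals $$\frac{(-1)^n}{\rho}\,\frac{\Gamma(n)\Gamma(N)}{\Gamma(N-n+1)}\,\frac{\Gamma(1-\frac N2-b)}{\Gamma(n+1-\frac N2-b)}\,\frac{\Gamma(1-\frac N2+b)}{\Gamma(n+1-\frac N2+b)},$$ and for every $\rho$ as above, including the exceptional ones, this expression, taken at $r$ in place of $\rho$ (also in $b$), tends to $q_n$ as $r\to\rho$, $r\ne\rho$. Finally, if $\rho=\frac1{N+1}$, then $q_n=\left(1+\frac1N\right)\frac1{n^2+n}$ for $1\le n\le N$, so that this is the limit of $\mathbb P(S_t=n)$. -/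

import Mathlib

open MeasureTheory ProbabilityTheory Filter Topology
open scoped NNReal

namespace YuleNetwork

noncomputable section

variable {Ω : Type*}

/-- Caputo derivative of order `ν ∈ (0, 1]` with base point `0`. For `ν ∈ (0, 1)` it is
`(1 / Γ (1 - ν)) ∫₀ᵗ f' s / (t - s) ^ ν ds`; for `ν = 1` it is the ordinary derivative. -/
def caputoDeriv (ν : ℝ) (f : ℝ → ℝ) (t : ℝ) : ℝ :=
  if ν = 1 then deriv f t
  else (1 / Real.Gamma (1 - ν)) * ∫ s in (0 : ℝ)..t, deriv f s / (t - s) ^ ν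

/-- State probability `p_n(t) = P(Y(t) = n)` of an integer-valued process. -/
def stateProb [MeasurableSpace Ω] (μ : Measure Ω) (Y : ℝ≥0 → Ω → ℕ) (n : ℕ) (t : ℝ) : ℝ :=
  μ.real {ω | Y t.toNNReal ω = n}

/-- `Y` is a fractional nonlinear birth process with fractionality parameter `ν` and birth rates
`rate 1, rate 2, …`, started from one individual: a counting process (right-continuous,
nondecreasing, unit jumps, no explosion since the values are natural numbers) whose state
probabilities solve the fractional difference-differential system
`d^ν p_n / dt^ν = - rate n * p_n + rate (n - 1) * p_{n-1}` for `n ≥ 1`, with `p_0 = 0` and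
`p_n(0) = δ_{n,1}` (the last two follow from `start` and `mono`). The equation of index `n + 1`
is written for `n ≥ 0`. -/
structure IsFractionalBirthProcess [MeasurableSpace Ω] (μ : Measure Ω) (ν : ℝ) (rate : ℕ → ℝ)
    (Y : ℝ≥0 → Ω → ℕ) : Prop where
  measurable : ∀ t, Measurable (Y t)
  start : ∀ ω, Y 0 ω = 1
  mono : ∀ ω, Monotone fun t => Y t ω
  rightCont : ∀ ω t, ContinuousWithinAt (fun s => Y s ω) (Set.Ici t) t
  unitJump : ∀ ω t, 0 < t → ∀ᶠ s in 𝓝[<] t, Y t ω ≤ Y s ω + 1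
  absCont : ∀ n : ℕ, ∀ T : ℝ, 0 ≤ T → AbsolutelyContinuousOnInterval (stateProb μ Y n) 0 T
  equation : ∀ n : ℕ, ∀ t : ℝ, 0 < t →
    caputoDeriv ν (stateProb μ Y (n + 1)) t
      = -rate (n + 1) * stateProb μ Y (n + 1) t + rate n * stateProb μ Y n t

/-- Creation time of page `k`, where page `0` is the initial page, created at time `0`, and
`gap i` is the time between the creations of pages `i` and `i + 1`. -/
def birthTime (gap : ℕ → Ω → ℝ) (k : ℕ) (ω : Ω) : ℝ :=
  ∑ i ∈ Finset.range k, gap i ω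

/-- Number of webpages present at time `t`. -/
def pageCount (gap : ℕ → Ω → ℝ) (t : ℝ) (ω : Ω) : ℕ :=
  {k : ℕ | birthTime gap k ω ≤ t}.ncard

/-- The `σ`-algebra generated by the whole network: creation times and in-link processes. -/
abbrev networkSigma (gap : ℕ → Ω → ℝ) (X : ℕ → ℝ≥0 → Ω → ℕ) : MeasurableSpace Ω :=
  MeasurableSpace.comap
    (fun ω => ((fun i => gap i ω, fun i s => X i s ω) : (ℕ → ℝ) × (ℕ → ℝ≥0 → ℕ)))
    inferInstance

/-- The generalized nonlinear Yule model.
* Webpages develop as a homogeneous Yule process of rate `β` started from one page: while `i + 1`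
  pages are present the waiting time `gap i` for the next page is exponential of rate
  `β * (i + 1)`, and the waiting times are independent.
* Each page `i` carries a fractional nonlinear birth process `X i` (run from the creation of the
  page) that counts its in-links; these are independent of each other and of the creation times.
* `pick t` is a page chosen uniformly at random at time `t`: given the network it is uniformly
  distributed on the pages present at time `t`. -/
structure IsGeneralizedYuleModel [MeasurableSpace Ω] (μ : Measure Ω) (β ν : ℝ) (rate : ℕ → ℝ)
    (gap : ℕ → Ω → ℝ) (X : ℕ → ℝ≥0 → Ω → ℕ) (pick : ℝ → Ω → ℕ) : Prop where
  gap_measurable : ∀ i, Measurable (gap i)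
  gap_law : ∀ i : ℕ, μ.map (gap i) = expMeasure (β * (i + 1))
  gap_indep : iIndepFun gap μ
  inlinks : ∀ i, IsFractionalBirthProcess μ ν rate (X i)
  inlinks_indep : iIndepFun (fun i ω => fun s : ℝ≥0 => X i s ω) μ
  gap_inlinks_indep : IndepFun (fun ω => fun i => gap i ω) (fun ω => fun i s => X i s ω) μ
  pick_measurable : ∀ t, Measurable (pick t)
  pick_uniform : ∀ t : ℝ, 0 ≤ t → ∀ k : ℕ, ∀ A : Set Ω, MeasurableSet[networkSigma gap X] A →
    μ.real (A ∩ {ω | pick t ω = k})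
      = ∫ ω in A, (if birthTime gap k ω ≤ t then ((pageCount gap t ω : ℝ))⁻¹ else 0) ∂μ

/-- Size (number of in-links) at time `t` of the page chosen uniformly at random at time `t`. -/
def pageSize (gap : ℕ → Ω → ℝ) (X : ℕ → ℝ≥0 → Ω → ℕ) (pick : ℝ → Ω → ℕ) (t : ℝ) (ω : Ω) : ℕ :=
  X (pick t ω) (t - birthTime gap (pick t ω) ω).toNNReal ω

/-- Saturating rates `λ r (N - r)` for `1 ≤ r ≤ N`. They vanish at `r = N`, so that states above
`N` are never reached; the rates there are set to `0`. -/
def saturatingRate (lam : ℝ) (N r : ℕ) : ℝ :=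
  if r ≤ N then lam * r * ((N : ℝ) - r) else 0

/-- The closed form with the factors `Γ(1 - N/2 ± √(N² + 4/ρ)/2)`. -/
def closedForm₁ (N : ℕ) (ρ : ℝ) (n : ℕ) : ℝ :=
  ((-1) ^ n / ρ) * (Real.Gamma n * Real.Gamma N / Real.Gamma ((N : ℝ) - n + 1))
    * (Real.Gamma (1 - (N : ℝ) / 2 - (1 / 2) * √((N : ℝ) ^ 2 + 4 / ρ))
        / Real.Gamma (n + 1 - (N : ℝ) / 2 - (1 / 2) * √((N : ℝ) ^ 2 + 4 / ρ)))
    * (Real.Gamma (1 - (N : ℝ) / 2 + (1 / 2) * √((N : ℝ) ^ 2 + 4 / ρ))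
        / Real.Gamma (n + 1 - (N : ℝ) / 2 + (1 / 2) * √((N : ℝ) ^ 2 + 4 / ρ)))

/-- The closed form all of whose Gamma factors have positive argument for `1 ≤ n ≤ N`, `ρ > 0`. -/
def closedForm₂ (N : ℕ) (ρ : ℝ) (n : ℕ) : ℝ :=
  ρ⁻¹ * (Real.Gamma n * Real.Gamma N / Real.Gamma ((N : ℝ) - n + 1))
    * (Real.Gamma ((1 / 2) * √((N : ℝ) ^ 2 + 4 / ρ) + 1 - (N : ℝ) / 2)
        / Real.Gamma ((1 / 2) * √((N : ℝ) ^ 2 + 4 / ρ) + 1 - (N : ℝ) / 2 + n))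
    * (Real.Gamma ((1 / 2) * √((N : ℝ) ^ 2 + 4 / ρ) + (N : ℝ) / 2 - n)
        / Real.Gamma ((1 / 2) * √((N : ℝ) ^ 2 + 4 / ρ) + (N : ℝ) / 2))

end

end YuleNetwork

namespace YuleNetwork

/-! ### The closed forms -/

/-! Almost surely the creation time of page k is log k / β plus a convergent sequence with a random
limit. When n pages are present, page ⌊nx⌋ with 0 < x < 1 therefore has age close to -log x / β: the
random limit cancels, and for uniform x this is an exponential variable of rate β. So the empirical
law of the ages tends to that exponential law (`tendsto_average_age`). The in-link processes are
independent of the creation times and, by uniqueness for the fractional system (`stateProb_unique`),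
share their state probabilities p_n. Hence P(S_t = n) tends to β ∫ e^(-βs) p_n(s) ds over s > 0
(`tendsto_measureReal_pageSize`).

The fractional order matters only through a Laplace transform. Inverting the Caputo derivative gives
a Volterra equation with kernel s^(ν-1)/Γ(ν), whose transform at β is β^(-ν). The limits q_n thus
satisfy (1 + ρ n(N-n)) q_n = ρ (n-1)(N-n+1) q_(n-1) for n ≥ 2, and (1 + ρ(N-1)) q_1 = 1. The
solution `limitMass` is a quotient by the product of the factors 1/ρ + j(N-j), 1 ≤ j ≤ n. The
recursion telescopes and the rate at N vanishes, so the masses add up to 1.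

With b as in the statement, 1/ρ + j(N-j) = (b - N/2 + j)(b + N/2 - j). Each linear factor yields a
Gamma quotient, and the second can be read with either sign, whence the two closed forms.
`limitMass` is continuous at every ρ > 0 and the exceptional values are isolated, so the first form
extends by continuity. -/

theorem Gamma_div_Gamma_add_nat {a : ℝ} (ha : ∀ m : ℕ, a ≠ -(m : ℝ)) (n : ℕ) :
    Real.Gamma a / Real.Gamma (a + n) = (∏ j ∈ Finset.range n, (a + j))⁻¹ := by
  induction n with
  | zero => simp [div_self (Real.Gamma_ne_zero ha)]
  | succ n ih =>
    have h0 : a + n ≠ 0 := fun h => ha n (by linarith)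
    rw [Finset.prod_range_succ, mul_inv, ← ih, Nat.cast_succ, ← add_assoc, Real.Gamma_add_one h0,
      mul_comm (a + n), div_mul_eq_div_div, div_eq_mul_inv _ (a + n)]

theorem Gamma_sub_nat_div_Gamma {c : ℝ} (n : ℕ) (hc : (n : ℝ) < c) :
    Real.Gamma (c - n) / Real.Gamma c = (∏ j ∈ Finset.range n, (c - 1 - j))⁻¹ := by
  induction n with
  | zero =>
    have : Real.Gamma c ≠ 0 := (Real.Gamma_pos_of_pos (by simpa using hc)).ne'
    simp [div_self this]
  | succ n ih =>
    push_cast at hc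
    have h0 : c - 1 - n ≠ 0 := by linarith
    have h1 : Real.Gamma (c - n) = (c - 1 - n) * Real.Gamma (c - (n + 1)) := by
      rw [show c - (n + 1) = c - 1 - n by ring, ← Real.Gamma_add_one h0]
      ring_nf
    rw [Finset.prod_range_succ, mul_inv, ← ih (by linarith), h1, Nat.cast_succ]
    field_simp

/-- The limiting mass function, written without the square root. -/
noncomputable def limitMass (N : ℕ) (r : ℝ) (n : ℕ) : ℝ :=
  r⁻¹ * (Real.Gamma n * Real.Gamma N / Real.Gamma ((N : ℝ) - n + 1)) *
    (∏ j ∈ Finset.range n, (1 / r + ((j : ℝ) + 1) * (N - (j + 1))))⁻¹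

theorem lt_sqrt_sq_add {N : ℕ} {r : ℝ} (hr : 0 < r) : (N : ℝ) < √((N : ℝ) ^ 2 + 4 / r) := by
  apply Real.lt_sqrt_of_sq_lt
  have : 0 < 4 / r := by positivity
  linarith

/-- The two Gamma quotients are products of s/2 ± a with a = N/2 - (j+1), and s²/4 - a² = 1/r +
(j+1)(N-(j+1)). Since s > N and n ≤ N, no Gamma argument reaches a pole. -/
theorem closedForm₂_eq_limitMass {N n : ℕ} {r : ℝ} (hr : 0 < r) (hn : n ≤ N) :
    closedForm₂ N r n = limitMass N r n := by
  have hs := lt_sqrt_sq_add (N := N) hr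
  have hs2 : √((N : ℝ) ^ 2 + 4 / r) ^ 2 = (N : ℝ) ^ 2 + 4 / r := Real.sq_sqrt (by positivity)
  have hn' : (n : ℝ) ≤ N := by exact_mod_cast hn
  unfold closedForm₂ limitMass
  set s := √((N : ℝ) ^ 2 + 4 / r)
  have ha : ∀ m : ℕ, (1 / 2) * s + 1 - (N : ℝ) / 2 ≠ -(m : ℝ) := fun m h => by
    have := m.cast_nonneg (α := ℝ); linarith
  rw [Gamma_div_Gamma_add_nat ha, Gamma_sub_nat_div_Gamma _ (by linarith), mul_assoc, ← mul_inv,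
    ← Finset.prod_mul_distrib]
  congr 2
  refine Finset.prod_congr rfl fun j _ => ?_
  linear_combination (1 / 4) * hs2

/-- Here each pair of factors multiplies to a² - s²/4, the opposite sign, and the prefactor (-1)^n
compensates. Only the branch with -s/2 can meet a pole, because s > N. -/
theorem closedForm₁_eq_limitMass {N n : ℕ} {r : ℝ} (hr : 0 < r)
    (h : ∀ m : ℕ, 1 - (N : ℝ) / 2 - (1 / 2) * √((N : ℝ) ^ 2 + 4 / r) ≠ -(m : ℝ)) :
    closedForm₁ N r n = limitMass N r n := by
  have hs := lt_sqrt_sq_add (N := N) hr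
  have hs2 : √((N : ℝ) ^ 2 + 4 / r) ^ 2 = (N : ℝ) ^ 2 + 4 / r := Real.sq_sqrt (by positivity)
  unfold closedForm₁ limitMass
  set s := √((N : ℝ) ^ 2 + 4 / r)
  have ha : ∀ m : ℕ, 1 - (N : ℝ) / 2 + (1 / 2) * s ≠ -(m : ℝ) := fun m h => by
    have := m.cast_nonneg (α := ℝ); linarith
  rw [show (n : ℝ) + 1 - N / 2 - (1 / 2) * s = (1 - (N : ℝ) / 2 - (1 / 2) * s) + n by ring,
    show (n : ℝ) + 1 - N / 2 + (1 / 2) * s = (1 - (N : ℝ) / 2 + (1 / 2) * s) + n by ring,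
    Gamma_div_Gamma_add_nat h, Gamma_div_Gamma_add_nat ha, mul_assoc, ← mul_inv,
    ← Finset.prod_mul_distrib]
  have hp : ∏ j ∈ Finset.range n,
        ((1 - (N : ℝ) / 2 - (1 / 2) * s + j) * (1 - (N : ℝ) / 2 + (1 / 2) * s + j))
      = (-1) ^ n * ∏ j ∈ Finset.range n, (1 / r + ((j : ℝ) + 1) * (N - (j + 1))) := by
    rw [← Finset.card_range n, ← Finset.prod_const, Finset.card_range,
      ← Finset.prod_mul_distrib]
    refine Finset.prod_congr rfl fun j _ => ?_
    linear_combination (-1 / 4) * hs2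
  have h1 : ((-1 : ℝ) ^ n)⁻¹ * (-1) ^ n = 1 := inv_mul_cancel₀ (by positivity)
  rw [hp, mul_inv]
  linear_combination (r⁻¹ * (Real.Gamma n * Real.Gamma N / Real.Gamma ((N : ℝ) - n + 1)) *
    (∏ j ∈ Finset.range n, (1 / r + ((j : ℝ) + 1) * (N - (j + 1))))⁻¹) * h1

theorem limitMass_factor_pos {N n : ℕ} {r : ℝ} (hr : 0 < r) (hn : n ≤ N) :
    0 < 1 / r + (n : ℝ) * (N - n) := by
  have hn' : (n : ℝ) ≤ N := by exact_mod_cast hn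
  have : 0 ≤ (n : ℝ) * (N - n) := mul_nonneg n.cast_nonneg (by linarith)
  positivity

theorem limitMass_one {N : ℕ} {r : ℝ} (hr : 0 < r) (hN : 1 ≤ N) :
    (1 + r * ((1 : ℕ) * ((N : ℝ) - (1 : ℕ)))) * limitMass N r 1 = 1 := by
  have h := limitMass_factor_pos hr hN
  have hG : Real.Gamma N ≠ 0 := (Real.Gamma_pos_of_pos (by positivity)).ne'
  simp only [Nat.cast_one] at h ⊢
  simp only [limitMass, Finset.prod_range_one, Nat.cast_one, Nat.cast_zero, zero_add,
    Real.Gamma_one, sub_add_cancel, one_mul, div_self hG, mul_one] at h ⊢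
  have e : 1 + r * ((N : ℝ) - 1) = r * (1 / r + (N - 1)) := by field_simp
  rw [e]
  generalize 1 / r + ((N : ℝ) - 1) = d at h
  field_simp

/-- The same recursion holds for the Laplace transforms of the state probabilities, which is how the
two are identified. -/
theorem limitMass_succ {N n : ℕ} {r : ℝ} (hr : 0 < r) (hn : 1 ≤ n) (hnN : n + 1 ≤ N) :
    (1 + r * ((n + 1 : ℕ) * ((N : ℝ) - (n + 1 : ℕ)))) * limitMass N r (n + 1)
      = r * (n * ((N : ℝ) - n)) * limitMass N r n := by
  have h := limitMass_factor_pos hr hnN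
  have hnN' : (n : ℝ) + 1 ≤ N := by exact_mod_cast hnN
  have hn0 : (n : ℝ) ≠ 0 := by positivity
  have hNn : (N : ℝ) - n ≠ 0 := by linarith
  have h1 : Real.Gamma ((N : ℝ) - n + 1) = (N - n) * Real.Gamma (N - n) :=
    Real.Gamma_add_one hNn
  have hG : Real.Gamma ((N : ℝ) - n) ≠ 0 := (Real.Gamma_pos_of_pos (by linarith)).ne'
  simp only [limitMass, Finset.prod_range_succ, Nat.cast_succ] at h ⊢
  rw [Real.Gamma_add_one hn0, h1, show (N : ℝ) - (n + 1) + 1 = N - n by ring, mul_inv]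
  have e : 1 + r * (((n : ℝ) + 1) * ((N : ℝ) - (n + 1)))
      = r * (1 / r + ((n : ℝ) + 1) * ((N : ℝ) - (n + 1))) := by field_simp
  rw [e]
  set d := 1 / r + ((n : ℝ) + 1) * ((N : ℝ) - (n + 1))
  field_simp

theorem sum_limitMass {N : ℕ} {r : ℝ} (hr : 0 < r) (hN : 1 ≤ N) :
    ∑ n ∈ Finset.Icc 1 N, limitMass N r n = 1 := by
  -- By the recursion q_(m+1) is a difference of consecutive values of r m(N-m) q_m. The sums
  -- telescope, and the remainder vanishes at m = N.
  have key : ∀ m, 1 ≤ m → m ≤ N →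
      ∑ n ∈ Finset.Icc 1 m, limitMass N r n = 1 - r * (m * ((N : ℝ) - m)) * limitMass N r m := by
    intro m hm
    induction m, hm using Nat.le_induction with
    | base =>
      intro _
      have := limitMass_one hr hN
      simp only [Finset.Icc_self, Finset.sum_singleton]
      linarith
    | succ m hm ih =>
      intro hmN
      have := limitMass_succ hr hm hmN
      rw [Finset.sum_Icc_succ_top (by lia), ih (by lia)]
      linarith
  simpa using key N hN le_rfl

theorem tendsto_limitMass {N n : ℕ} {r : ℝ} (hr : 0 < r) (hn : n ≤ N) :
    Tendsto (fun x => limitMass N x n) (𝓝 r) (𝓝 (limitMass N r n)) := by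
  have hr' := hr.ne'
  refine (((continuousAt_id.inv₀ hr').mul continuousAt_const).mul (ContinuousAt.inv₀ ?_ ?_)).tendsto
  · exact tendsto_finsetProd _ fun j _ => (continuousAt_const.div continuousAt_id hr').add_const _
  · refine Finset.prod_ne_zero_iff.2 fun j hj => ?_
    have := limitMass_factor_pos (n := j + 1) (N := N) hr (by grind)
    push_cast at this
    exact this.ne'

/-- The argument of the Gamma function is continuous and injective in r > 0, and the nonpositive
integers are discrete, so the exceptional values are isolated. -/
theorem eventually_nonexceptional {N : ℕ} {ρ : ℝ} (hρ : 0 < ρ) :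
    ∀ᶠ r in 𝓝[≠] ρ, ∀ m : ℕ, 1 - (N : ℝ) / 2 - (1 / 2) * √((N : ℝ) ^ 2 + 4 / r) ≠ -(m : ℝ) := by
  set f : ℝ → ℝ := fun r => 1 - (N : ℝ) / 2 - (1 / 2) * √((N : ℝ) ^ 2 + 4 / r) with hf
  have hcont : Tendsto f (𝓝 ρ) (𝓝 (f ρ)) := by
    have : ContinuousAt (fun r : ℝ => 4 / r) ρ := continuousAt_const.div continuousAt_id hρ.ne'
    exact (continuousAt_const.sub (((continuousAt_const.add this).sqrt).const_mul (1 / 2))).tendsto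
  have hinj : ∀ r, 0 < r → f r = f ρ → r = ρ := by
    intro r hr h
    have h1 : √((N : ℝ) ^ 2 + 4 / r) = √((N : ℝ) ^ 2 + 4 / ρ) := by simp only [hf] at h; linarith
    rw [Real.sqrt_inj (by positivity) (by positivity)] at h1
    field_simp at h1
    linarith
  have hiso : ∀ᶠ y in 𝓝 (f ρ), ∀ m : ℕ, y = -(m : ℝ) → y = f ρ := by
    have hcl : IsClosed ((fun m : ℕ => (m : ℝ)) '' {m | -(m : ℝ) ≠ f ρ}) :=
      Nat.isClosedEmbedding_coe_real.isClosedMap _ (isClosed_discrete _)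
    have hmem : -f ρ ∈ ((fun m : ℕ => (m : ℝ)) '' {m | -(m : ℝ) ≠ f ρ})ᶜ := by
      rintro ⟨m, hm, h⟩
      exact hm (by simp only at h; linarith)
    filter_upwards [continuous_neg.continuousAt.eventually (hcl.isOpen_compl.mem_nhds hmem)]
      with y hy m hm
    by_contra hne
    exact hy ⟨m, fun h => hne (hm.trans h), by simp [hm]⟩
  have hpos : ∀ᶠ r in 𝓝[≠] ρ, 0 < r := nhdsWithin_le_nhds (lt_mem_nhds hρ)
  filter_upwards [hpos, nhdsWithin_le_nhds (hcont.eventually hiso), self_mem_nhdsWithin]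
    with r hr h hne m hm
  exact hne (hinj r hr (h m hm))

/-! ### Fractional calculus -/

-- A beta integral whose exponents sum to -1, so that scaling leaves no power of x: the two
-- fractional kernels convolve to a constant.
open Set in
theorem integral_rpow_mul_rpow_sub {ν x : ℝ} (hν₀ : 0 < ν) (hν₁ : ν < 1) (hx : 0 < x) :
    ∫ s in (0 : ℝ)..x, s ^ (-ν) * (x - s) ^ (ν - 1) = Real.Gamma (1 - ν) * Real.Gamma ν := by
  have h := Complex.betaIntegral_scaled (1 - ν : ℝ) (ν : ℝ) hx
  rw [Complex.betaIntegral_eq_Gamma_mul_div _ _ (by simpa using hν₁) (by simpa using hν₀),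
    Complex.Gamma_ofReal, Complex.Gamma_ofReal] at h
  have e : ((1 - ν : ℝ) : ℂ) + (ν : ℝ) = 1 := by push_cast; ring
  rw [e, sub_self, Complex.cpow_zero, Complex.Gamma_one, div_one, one_mul, ← Complex.ofReal_mul] at h
  apply Complex.ofReal_injective
  rw [← h, ← intervalIntegral.integral_ofReal]
  refine intervalIntegral.integral_congr fun s hs => ?_
  rw [uIcc_of_le hx.le] at hs
  rw [Complex.ofReal_mul, Complex.ofReal_cpow hs.1, Complex.ofReal_cpow (by linarith [hs.2])]
  push_cast
  ring_nf

-- Truncation to (0, t) makes the kernels integrable on the whole line without changing one-sided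
-- convolutions up to time t, so associativity of convolution becomes available.
open Set in
theorem convolution_indicator_Ioo (F G : ℝ → ℝ) {u t : ℝ} (hu : 0 < u) (hut : u ≤ t) :
    convolution ((Ioo 0 t).indicator F) ((Ioo 0 t).indicator G) (ContinuousLinearMap.mul ℝ ℝ)
      volume u = ∫ s in (0 : ℝ)..u, F s * G (u - s) := by
  rw [convolution_def, intervalIntegral.integral_of_le hu.le, integral_Ioc_eq_integral_Ioo,
    ← integral_indicator measurableSet_Ioo]
  congr 1 with s
  simp only [ContinuousLinearMap.mul_apply', indicator, mem_Ioo]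
  split_ifs <;> grind

/-- The Riemann–Liouville fractional integral of order `ν`. -/
noncomputable def fracIntegral (ν : ℝ) (g : ℝ → ℝ) (t : ℝ) : ℝ :=
  (1 / Real.Gamma ν) * ∫ s in (0 : ℝ)..t, g s * (t - s) ^ (ν - 1)

open Set in
theorem integrable_indicator_Ioo_rpow {t a : ℝ} (ha : -1 < a) :
    Integrable ((Ioo 0 t).indicator fun x : ℝ => x ^ a) :=
  (integrable_indicator_iff measurableSet_Ioo).2
    (((intervalIntegral.intervalIntegrable_rpow' ha (a := 0) (b := t)).1).mono_set
      Ioo_subset_Ioc_self)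

open Set in
/-- The semigroup law `I^ν I^(1-ν) = I^1` for fractional integrals. -/
theorem fracIntegral_fracIntegral_one_sub {ν t : ℝ} {φ : ℝ → ℝ} (hν₀ : 0 < ν) (hν₁ : ν < 1)
    (ht : 0 < t) (hφ : IntervalIntegrable φ volume 0 t) :
    ∫ u in (0 : ℝ)..t, (∫ s in (0 : ℝ)..u, φ s * (u - s) ^ (-ν)) * (t - u) ^ (ν - 1)
      = Real.Gamma (1 - ν) * Real.Gamma ν * ∫ s in (0 : ℝ)..t, φ s := by
  set f := (Ioo 0 t).indicator φ with hf
  set g := (Ioo 0 t).indicator fun x : ℝ => x ^ (-ν) with hg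
  set k := (Ioo 0 t).indicator fun x : ℝ => x ^ (ν - 1) with hk
  set L := ContinuousLinearMap.mul ℝ ℝ with hL
  have hfi : Integrable f := (integrable_indicator_iff measurableSet_Ioo).2
    (hφ.1.mono_set Ioo_subset_Ioc_self)
  have hgi : Integrable g := integrable_indicator_Ioo_rpow (by linarith)
  have hki : Integrable k := integrable_indicator_Ioo_rpow (by linarith)
  have hgk : ∀ x ∈ Ioc 0 t, convolution g k L volume x = Real.Gamma (1 - ν) * Real.Gamma ν :=
    fun x hx => by
      rw [hg, hk, convolution_indicator_Ioo _ _ hx.1 hx.2,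
        integral_rpow_mul_rpow_sub hν₀ hν₁ hx.1]
  have hng : (fun x => ‖g x‖) = g := by
    ext x
    simp only [hg, indicator]
    split_ifs with h
    · exact Real.norm_of_nonneg (Real.rpow_nonneg h.1.le _)
    · simp
  have hnk : (fun x => ‖k x‖) = k := by
    ext x
    simp only [hk, indicator]
    split_ifs with h
    · exact Real.norm_of_nonneg (Real.rpow_nonneg h.1.le _)
    · simp
  -- The last hypothesis, existence at t of the convolution of the norms, holds because ‖g‖ ⋆ ‖k‖ is
  -- constant on (0, t] by `hgk`.
  have hassoc := convolution_assoc (μ := volume) (ν := volume) L L L L (x₀ := t) (f := f) (g := g)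
    (k := k) (fun x y z => by simp [hL, mul_assoc])
    hfi.aestronglyMeasurable hgi.aestronglyMeasurable hki.aestronglyMeasurable
    (hfi.ae_convolution_exists L hgi) (hgi.norm.ae_convolution_exists L hki.norm) (by
      rw [hng, hnk, ConvolutionExistsAt]
      refine (hfi.norm.mul_const (Real.Gamma (1 - ν) * Real.Gamma ν)).congr
        (Eventually.of_forall fun s => ?_)
      simp only [ContinuousLinearMap.mul_apply']
      by_cases hs : s ∈ Ioo 0 t
      · rw [hgk (t - s) ⟨by linarith [hs.2], by linarith [hs.1]⟩]
      · simp [hf, hs])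
  have h1 : convolution (convolution f g L volume) k L volume t
      = ∫ u in (0 : ℝ)..t, (∫ s in (0 : ℝ)..u, φ s * (u - s) ^ (-ν)) * (t - u) ^ (ν - 1) := by
    rw [convolution_def, intervalIntegral.integral_of_le ht.le, integral_Ioc_eq_integral_Ioo,
      ← integral_indicator measurableSet_Ioo]
    congr 1 with u
    by_cases hu : u ∈ Ioo 0 t
    · have hu' : t - u ∈ Ioo 0 t := ⟨by linarith [hu.2], by linarith [hu.1]⟩
      rw [hf, hg, convolution_indicator_Ioo _ _ hu.1 hu.2.le, indicator_of_mem hu, hk,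
        indicator_of_mem hu', hL, ContinuousLinearMap.mul_apply']
    · have hu' : t - u ∉ Ioo 0 t := fun h => hu ⟨by linarith [h.2], by linarith [h.1]⟩
      simp [hk, hu, hu', hL]
  have h2 : convolution f (convolution g k L volume) L volume t
      = Real.Gamma (1 - ν) * Real.Gamma ν * ∫ s in (0 : ℝ)..t, φ s := by
    rw [convolution_def, intervalIntegral.integral_of_le ht.le, integral_Ioc_eq_integral_Ioo,
      ← integral_indicator measurableSet_Ioo, ← integral_const_mul]
    congr 1 with s
    by_cases hs : s ∈ Ioo 0 t
    · rw [hgk (t - s) ⟨by linarith [hs.2], by linarith [hs.1]⟩, hf, hL,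
        ContinuousLinearMap.mul_apply', mul_comm]
    · simp [hf, hs, hL]
  rw [← h1, ← h2, hassoc]

open Set in
/-- An absolutely continuous function is recovered from its Caputo derivative. -/
theorem sub_eq_fracIntegral_of_caputoDeriv {ν t : ℝ} {f g : ℝ → ℝ} (hν₀ : 0 < ν) (hν₁ : ν ≤ 1)
    (ht : 0 ≤ t) (hf : AbsolutelyContinuousOnInterval f 0 t)
    (hg : ∀ u, 0 < u → caputoDeriv ν f u = g u) :
    f t - f 0 = fracIntegral ν g t := by
  rcases ht.eq_or_lt with rfl | ht
  · simp [fracIntegral]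
  rw [← hf.integral_deriv_eq_sub, fracIntegral]
  rcases hν₁.eq_or_lt with rfl | hν₁
  · rw [Real.Gamma_one, div_one, one_mul]
    refine intervalIntegral.integral_congr_ae (Eventually.of_forall fun u hu => ?_)
    rw [uIoc_of_le ht.le] at hu
    have := hg u hu.1
    simp only [caputoDeriv, if_true] at this
    simp [this]
  · have hG : Real.Gamma ν ≠ 0 := (Real.Gamma_pos_of_pos hν₀).ne'
    have hG' : Real.Gamma (1 - ν) ≠ 0 := (Real.Gamma_pos_of_pos (by linarith)).ne'
    have h := fracIntegral_fracIntegral_one_sub hν₀ hν₁ ht hf.intervalIntegrable_deriv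
    have h' : ∫ u in (0 : ℝ)..t, g u * (t - u) ^ (ν - 1)
        = (1 / Real.Gamma (1 - ν)) * ∫ u in (0 : ℝ)..t,
          (∫ s in (0 : ℝ)..u, deriv f s * (u - s) ^ (-ν)) * (t - u) ^ (ν - 1) := by
      rw [← intervalIntegral.integral_const_mul]
      refine intervalIntegral.integral_congr_ae (Eventually.of_forall fun u hu => ?_)
      rw [uIoc_of_le ht.le] at hu
      rw [← hg u hu.1, caputoDeriv, if_neg hν₁.ne, mul_assoc]
      congr 2
      refine intervalIntegral.integral_congr fun s hs => ?_
      rw [uIcc_of_le hu.1.le] at hs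
      rw [Real.rpow_neg (by linarith [hs.2]), div_eq_mul_inv]
    rw [h', h]
    field_simp

-- Splitting the weight as e^(-cs) e^(-c(t-s)) makes the damped fractional integral a convolution of
-- damped functions, whose integral factors.
open Set in
theorem exp_mul_fracIntegral_eq {ν c : ℝ} (g : ℝ → ℝ) (t : ℝ) :
    Real.exp (-c * t) * fracIntegral ν g t = (1 / Real.Gamma ν) *
      ∫ s in (0 : ℝ)..t, ContinuousLinearMap.mul ℝ ℝ (Real.exp (-c * s) * g s)
        ((t - s) ^ (ν - 1) * Real.exp (-(c * (t - s)))) := by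
  rw [fracIntegral, mul_left_comm, ← intervalIntegral.integral_const_mul]
  congr 2 with s
  rw [ContinuousLinearMap.mul_apply', show -c * t = -c * s + -(c * (t - s)) by ring, Real.exp_add]
  ring

open Set in
theorem integrableOn_rpow_mul_exp {ν c : ℝ} (hν : 0 < ν) (hc : 0 < c) :
    IntegrableOn (fun t : ℝ => t ^ (ν - 1) * Real.exp (-(c * t))) (Ioi 0) := by
  have := integrableOn_rpow_mul_exp_neg_mul_rpow (p := 1) (s := ν - 1) (by linarith) one_pos hc
  simpa using this

open Set in
theorem integrableOn_exp_mul_fracIntegral {ν c : ℝ} {g : ℝ → ℝ} (hν : 0 < ν) (hc : 0 < c)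
    (hg : IntegrableOn (fun s => Real.exp (-c * s) * g s) (Ioi 0)) :
    IntegrableOn (fun t => Real.exp (-c * t) * fracIntegral ν g t) (Ioi 0) := by
  have h := integrable_posConvolution hg (integrableOn_rpow_mul_exp hν hc)
    (ContinuousLinearMap.mul ℝ ℝ)
  refine ((h.const_mul (1 / Real.Gamma ν)).integrableOn (s := Ioi 0)).congr_fun (fun t ht => ?_)
    measurableSet_Ioi
  simp only
  rw [posConvolution, indicator_of_mem ht, exp_mul_fracIntegral_eq]

open Set in
/-- The Laplace transform of a fractional integral. -/
theorem laplace_fracIntegral {ν c : ℝ} {g : ℝ → ℝ} (hν : 0 < ν) (hc : 0 < c)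
    (hg : IntegrableOn (fun s => Real.exp (-c * s) * g s) (Ioi 0)) :
    ∫ t in Ioi (0 : ℝ), Real.exp (-c * t) * fracIntegral ν g t
      = c ^ (-ν) * ∫ s in Ioi (0 : ℝ), Real.exp (-c * s) * g s := by
  have hG : Real.Gamma ν ≠ 0 := (Real.Gamma_pos_of_pos hν).ne'
  simp_rw [exp_mul_fracIntegral_eq, integral_const_mul]
  rw [integral_posConvolution hg (integrableOn_rpow_mul_exp hν hc) (ContinuousLinearMap.mul ℝ ℝ),
    Real.integral_rpow_mul_exp_neg_mul_Ioi hν hc, ContinuousLinearMap.mul_apply', one_div c,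
    Real.inv_rpow hc.le, Real.rpow_neg hc.le]
  field_simp

open Set in
theorem integrableOn_exp_mul_of_bounded {c M : ℝ} {f : ℝ → ℝ} (hc : 0 < c) (hf : Continuous f)
    (hM : ∀ t, |f t| ≤ M) : IntegrableOn (fun s => Real.exp (-c * s) * f s) (Ioi 0) := by
  have h : IntegrableOn (fun s : ℝ => Real.exp (-c * s)) (Ioi 0) :=
    integrableOn_exp_mul_Ioi (by linarith) 0
  exact h.mul_bdd (c := M) hf.aestronglyMeasurable (Eventually.of_forall hM)

open Set in
/-- Uniqueness for the linear fractional integral equation. -/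
theorem eq_zero_of_eq_mul_fracIntegral {ν a M : ℝ} {f : ℝ → ℝ} (hν : 0 < ν) (hf : Continuous f)
    (hM : ∀ t, |f t| ≤ M) (h : ∀ t, 0 < t → f t = a * fracIntegral ν f t) :
    ∀ t, 0 < t → f t = 0 := by
  -- In the L¹ norm with weight e^(-ct), fractional integration has norm at most c^(-ν), so a large
  -- c turns the equation into a contraction.
  obtain ⟨c, hc, hc2⟩ : ∃ c : ℝ, 0 < c ∧ |a| * c ^ (-ν) < 1 := by
    have h0 : Tendsto (fun c : ℝ => |a| * c ^ (-ν)) atTop (𝓝 0) := by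
      simpa using (tendsto_rpow_neg_atTop hν).const_mul |a|
    obtain ⟨c, h1, h2⟩ := ((h0.eventually_lt_const one_pos).and (eventually_gt_atTop 0)).exists
    exact ⟨c, h2, h1⟩
  have hint : IntegrableOn (fun s => Real.exp (-c * s) * |f s|) (Ioi 0) :=
    integrableOn_exp_mul_of_bounded hc hf.abs (M := M) (by simpa using hM)
  have hle : ∀ t, 0 < t → |f t| ≤ |a| * fracIntegral ν (fun s => |f s|) t := by
    intro t ht
    rw [h t ht, abs_mul, fracIntegral, fracIntegral, abs_mul,
      abs_of_pos (one_div_pos.2 (Real.Gamma_pos_of_pos hν))]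
    have := Real.Gamma_pos_of_pos hν
    gcongr
    refine (intervalIntegral.abs_integral_le_integral_abs ht.le).trans_eq
      (intervalIntegral.integral_congr fun s hs => ?_)
    rw [uIcc_of_le ht.le] at hs
    rw [abs_mul, abs_of_nonneg (Real.rpow_nonneg (by linarith [hs.2]) _)]
  set I := ∫ s in Ioi (0 : ℝ), Real.exp (-c * s) * |f s| with hI
  have hI0 : 0 ≤ I := setIntegral_nonneg measurableSet_Ioi fun s _ => by positivity
  have hI1 : I ≤ |a| * c ^ (-ν) * I := by
    rw [mul_assoc, hI, ← laplace_fracIntegral hν hc hint, ← integral_const_mul]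
    refine setIntegral_mono_on hint ((integrableOn_exp_mul_fracIntegral hν hc hint).const_mul _)
      measurableSet_Ioi fun t ht => ?_
    rw [mul_left_comm]
    gcongr
    exact hle t ht
  have hI2 : I = 0 := by nlinarith
  have hae := (setIntegral_eq_zero_iff_of_nonneg_ae
    (Eventually.of_forall fun s => by simp only [Pi.zero_apply]; positivity) hint).1 hI2
  -- The contraction gives vanishing almost everywhere; continuity gives it everywhere.
  have heq := Measure.eqOn_open_of_ae_eq hae isOpen_Ioi (by fun_prop) (by fun_prop)
  intro t ht
  have := heq ht
  simpa using this

/-! ### State probabilities of the fractional birth process -/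

theorem continuous_mul_rpow_intervalIntegrable {ν t : ℝ} {g : ℝ → ℝ} (hν : 0 < ν)
    (hg : Continuous g) :
    IntervalIntegrable (fun s => g s * (t - s) ^ (ν - 1)) volume 0 t := by
  have h := (intervalIntegral.intervalIntegrable_rpow' (r := ν - 1) (by linarith)
    (a := 0) (b := t)).comp_sub_left t
  simp only [sub_zero, sub_self] at h
  exact h.symm.continuousOn_mul hg.continuousOn

theorem fracIntegral_sub {ν t : ℝ} {g h : ℝ → ℝ} (hν : 0 < ν) (hg : Continuous g)
    (hh : Continuous h) :
    fracIntegral ν (fun s => g s - h s) t = fracIntegral ν g t - fracIntegral ν h t := by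
  simp only [fracIntegral, sub_mul]
  rw [intervalIntegral.integral_sub (continuous_mul_rpow_intervalIntegrable hν hg)
    (continuous_mul_rpow_intervalIntegrable hν hh), mul_sub]

theorem fracIntegral_const_mul {ν t a : ℝ} (g : ℝ → ℝ) :
    fracIntegral ν (fun s => a * g s) t = a * fracIntegral ν g t := by
  simp only [fracIntegral, mul_assoc, intervalIntegral.integral_const_mul]
  ring

section StateProb

variable {Ω : Type*} [MeasurableSpace Ω] {μ : Measure Ω} [IsProbabilityMeasure μ]
  {ν : ℝ} {rate : ℕ → ℝ} {Y Y' : ℝ≥0 → Ω → ℕ}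

theorem abs_stateProb_le (n : ℕ) (t : ℝ) : |stateProb μ Y n t| ≤ 1 := by
  rw [stateProb, abs_of_nonneg measureReal_nonneg]
  exact measureReal_le_one

namespace IsFractionalBirthProcess

omit [IsProbabilityMeasure μ] in
theorem continuous_stateProb (h : IsFractionalBirthProcess μ ν rate Y) (n : ℕ) :
    Continuous (stateProb μ Y n) := by
  have h1 : ContinuousOn (stateProb μ Y n) (Set.Ici 0) := by
    intro t ht
    have h2 := (h.absCont n (t + 1) (by linarith [Set.mem_Ici.1 ht])).continuousOn
    rw [Set.uIcc_of_le (by linarith [Set.mem_Ici.1 ht])] at h2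
    refine (h2 t ⟨ht, by linarith⟩).mono_of_mem_nhdsWithin ?_
    rw [← Set.Ici_inter_Iic]
    exact Filter.inter_mem self_mem_nhdsWithin (nhdsWithin_le_nhds (Iic_mem_nhds (by linarith)))
  -- Negative times are clamped to 0 by `toNNReal`, so continuity on [0, ∞) suffices.
  have h3 : stateProb μ Y n = fun t => stateProb μ Y n (max t 0) := by
    ext t
    have : (max t 0).toNNReal = t.toNNReal := by ext; simp
    simp only [stateProb, this]
  rw [h3]
  exact h1.comp_continuous (by fun_prop) fun t => Set.mem_Ici.2 (le_max_right _ _)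

theorem stateProb_of_nonpos (h : IsFractionalBirthProcess μ ν rate Y) (n : ℕ) {t : ℝ}
    (ht : t ≤ 0) : stateProb μ Y n t = if n = 1 then 1 else 0 := by
  simp only [stateProb, Real.toNNReal_of_nonpos ht, h.start]
  split_ifs with hn
  · simp [hn]
  · simp [Ne.symm hn]

omit [IsProbabilityMeasure μ] in
theorem stateProb_zero_left (h : IsFractionalBirthProcess μ ν rate Y) :
    stateProb μ Y 0 = fun _ => 0 := by
  ext t
  have h1 : ∀ ω, Y t.toNNReal ω ≠ 0 := fun ω => by
    have h2 : Y 0 ω ≤ Y t.toNNReal ω := h.mono ω (zero_le : 0 ≤ t.toNNReal)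
    rw [h.start] at h2
    lia
  simp [stateProb, h1]

/-- The Volterra form of the system: it is linear in p_(n+1) with p_n as a source, which suits both
uniqueness by induction and Laplace transforms. -/
theorem stateProb_succ_eq (h : IsFractionalBirthProcess μ ν rate Y) (hν₀ : 0 < ν) (hν₁ : ν ≤ 1)
    (n : ℕ) {t : ℝ} (ht : 0 ≤ t) :
    stateProb μ Y (n + 1) t = (if n = 0 then 1 else 0) + fracIntegral ν
      (fun u => -rate (n + 1) * stateProb μ Y (n + 1) u + rate n * stateProb μ Y n u) t := by
  rw [← sub_eq_fracIntegral_of_caputoDeriv hν₀ hν₁ ht (h.absCont (n + 1) t ht)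
    (h.equation n), h.stateProb_of_nonpos (n + 1) le_rfl]
  simp

/-- The fractional system determines the state probabilities. -/
theorem stateProb_unique (h : IsFractionalBirthProcess μ ν rate Y)
    (h' : IsFractionalBirthProcess μ ν rate Y') (hν₀ : 0 < ν) (hν₁ : ν ≤ 1) (n : ℕ) :
    stateProb μ Y n = stateProb μ Y' n := by
  induction n with
  | zero => rw [h.stateProb_zero_left, h'.stateProb_zero_left]
  | succ n ih =>
    have hc := h.continuous_stateProb
    have hc' := h'.continuous_stateProb
    -- By induction the source terms cancel, so the difference of two solutions solves the
    -- homogeneous equation. The bound 2 comes from two probabilities.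
    have key := eq_zero_of_eq_mul_fracIntegral (ν := ν) (a := -rate (n + 1)) (M := 2)
      (f := fun t => stateProb μ Y (n + 1) t - stateProb μ Y' (n + 1) t) hν₀
      ((hc _).sub (hc' _)) (fun t => by
        have h1 := abs_le.1 (abs_stateProb_le (μ := μ) (Y := Y) (n + 1) t)
        have h2 := abs_le.1 (abs_stateProb_le (μ := μ) (Y := Y') (n + 1) t)
        exact abs_le.2 ⟨by linarith, by linarith⟩) (fun t ht => by
        rw [h.stateProb_succ_eq hν₀ hν₁ n ht.le, h'.stateProb_succ_eq hν₀ hν₁ n ht.le,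
          add_sub_add_left_eq_sub, ← fracIntegral_sub hν₀
          (((hc _).const_mul _).fun_add ((hc _).const_mul _))
          (((hc' _).const_mul _).fun_add ((hc' _).const_mul _)), ← fracIntegral_const_mul, ih]
        congr 1 with s
        ring)
    ext t
    rcases le_or_gt t 0 with ht | ht
    · rw [h.stateProb_of_nonpos _ ht, h'.stateProb_of_nonpos _ ht]
    · exact sub_eq_zero.1 (key t ht)

theorem integrableOn_exp_mul_stateProb (h : IsFractionalBirthProcess μ ν rate Y) {c : ℝ}
    (hc : 0 < c) (n : ℕ) :
    IntegrableOn (fun s => Real.exp (-c * s) * stateProb μ Y n s) (Set.Ioi 0) :=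
  integrableOn_exp_mul_of_bounded hc (h.continuous_stateProb n) (abs_stateProb_le n)

/-- Recursion for the Laplace transforms of the state probabilities. -/
theorem laplace_stateProb_succ (h : IsFractionalBirthProcess μ ν rate Y) (hν₀ : 0 < ν)
    (hν₁ : ν ≤ 1) {c : ℝ} (hc : 0 < c) (n : ℕ) :
    ∫ s in Set.Ioi (0 : ℝ), Real.exp (-c * s) * stateProb μ Y (n + 1) s
      = (if n = 0 then 1 else 0) / c + c ^ (-ν) *
        (-rate (n + 1) * (∫ s in Set.Ioi (0 : ℝ), Real.exp (-c * s) * stateProb μ Y (n + 1) s)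
          + rate n * ∫ s in Set.Ioi (0 : ℝ), Real.exp (-c * s) * stateProb μ Y n s) := by
  set g := fun u => -rate (n + 1) * stateProb μ Y (n + 1) u + rate n * stateProb μ Y n u with hg
  have hi1 := (h.integrableOn_exp_mul_stateProb hc (n + 1)).const_mul (-rate (n + 1))
  have hi0 := (h.integrableOn_exp_mul_stateProb hc n).const_mul (rate n)
  have hge : (fun s => Real.exp (-c * s) * g s) = fun s =>
      -rate (n + 1) * (Real.exp (-c * s) * stateProb μ Y (n + 1) s)
        + rate n * (Real.exp (-c * s) * stateProb μ Y n s) := by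
    ext s
    simp only [hg]
    ring
  have hgi : IntegrableOn (fun s => Real.exp (-c * s) * g s) (Set.Ioi 0) := by
    rw [hge]
    exact hi1.add hi0
  have he : IntegrableOn (fun s : ℝ => Real.exp (-c * s)) (Set.Ioi 0) :=
    integrableOn_exp_mul_Ioi (by linarith) 0
  have h1 : ∫ s in Set.Ioi (0 : ℝ), Real.exp (-c * s) * stateProb μ Y (n + 1) s
      = ∫ s in Set.Ioi (0 : ℝ), (Real.exp (-c * s) * (if n = 0 then 1 else 0)
        + Real.exp (-c * s) * fracIntegral ν g s) := by
    refine setIntegral_congr_fun measurableSet_Ioi fun s hs => ?_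
    rw [h.stateProb_succ_eq hν₀ hν₁ n (le_of_lt hs), mul_add]
  refine h1.trans ?_
  rw [integral_add (he.mul_const _) (integrableOn_exp_mul_fracIntegral hν₀ hc hgi),
    laplace_fracIntegral hν₀ hc hgi, hge, integral_add hi1 hi0, integral_const_mul,
    integral_const_mul, integral_mul_const, integral_exp_mul_Ioi (by linarith)]
  simp [div_eq_mul_inv, mul_comm]

/-- For saturating rates, the state at an independent exponential time has the limiting law. -/
theorem mul_laplace_stateProb_eq_limitMass {lam β : ℝ} {N : ℕ}
    (h : IsFractionalBirthProcess μ ν (saturatingRate lam N) Y) (hν₀ : 0 < ν) (hν₁ : ν ≤ 1)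
    (hβ : 0 < β) (hlam : 0 < lam) {n : ℕ} (hn : 1 ≤ n) (hnN : n ≤ N) :
    β * ∫ s in Set.Ioi (0 : ℝ), Real.exp (-β * s) * stateProb μ Y n s
      = limitMass N (lam / β ^ ν) n := by
  have hρ : 0 < lam / β ^ ν := by positivity
  have hρ' : lam / β ^ ν = β ^ (-ν) * lam := by rw [Real.rpow_neg hβ.le, div_eq_inv_mul]
  induction n, hn using Nat.le_induction with
  | base =>
    have h1 := h.laplace_stateProb_succ hν₀ hν₁ hβ 0
    have h2 := limitMass_one hρ hnN
    simp only [saturatingRate, zero_add, hnN, zero_le, if_true, Nat.cast_zero, mul_zero,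
      zero_mul, add_zero] at h1
    set I := ∫ s in Set.Ioi (0 : ℝ), Real.exp (-β * s) * stateProb μ Y 1 s
    -- The unknown transform stands on both sides of `h1`; collecting it produces this factor.
    have h3 : (1 + lam / β ^ ν * ((1 : ℕ) * ((N : ℝ) - (1 : ℕ)))) * (β * I) = 1 := by
      have : β * I = 1 + β * (β ^ (-ν) * (-(lam * (1 : ℕ) * ((N : ℝ) - (1 : ℕ))) * I)) := by
        conv_lhs => rw [h1]
        field_simp
      rw [hρ']
      linear_combination this
    have h4 : 1 + lam / β ^ ν * ((1 : ℕ) * ((N : ℝ) - (1 : ℕ))) ≠ 0 := by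
      intro h0; rw [h0, zero_mul] at h3; exact zero_ne_one h3
    exact mul_left_cancel₀ h4 (h3.trans h2.symm)
  | succ n hn ih =>
    have h1 := h.laplace_stateProb_succ hν₀ hν₁ hβ n
    have h2 := limitMass_succ hρ hn hnN
    have hf := limitMass_factor_pos hρ hnN
    rw [← ih (by lia)] at h2
    simp only [saturatingRate, hnN, (by lia : n ≤ N), (by lia : n ≠ 0), if_true, if_false,
      zero_div, zero_add] at h1
    set I := ∫ s in Set.Ioi (0 : ℝ), Real.exp (-β * s) * stateProb μ Y (n + 1) s
    set J := ∫ s in Set.Ioi (0 : ℝ), Real.exp (-β * s) * stateProb μ Y n s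
    have h4 : 1 + lam / β ^ ν * ((n + 1 : ℕ) * ((N : ℝ) - (n + 1 : ℕ))) ≠ 0 := by
      have e : 1 + lam / β ^ ν * ((n + 1 : ℕ) * ((N : ℝ) - (n + 1 : ℕ)))
        = lam / β ^ ν * (1 / (lam / β ^ ν) + (n + 1 : ℕ) * ((N : ℝ) - (n + 1 : ℕ))) := by
        rw [mul_add, mul_one_div_cancel hρ.ne']
      rw [e]
      exact (mul_pos hρ hf).ne'
    refine mul_left_cancel₀ h4 (Eq.trans ?_ h2.symm)
    rw [hρ']
    linear_combination β * h1

end IsFractionalBirthProcess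

end StateProb

/-! ### Creation times -/

/-- The partial sums form a martingale bounded in L², hence in L¹, and Doob's convergence theorem
applies. -/
theorem exists_ae_tendsto_sum_of_summable_variance {Ω : Type*} [MeasurableSpace Ω] {μ : Measure Ω}
    [IsProbabilityMeasure μ] {ξ : ℕ → Ω → ℝ} (hm : ∀ i, Measurable (ξ i)) (hind : iIndepFun ξ μ)
    (hL2 : ∀ i, MemLp (ξ i) 2 μ) (hmean : ∀ i, ∫ ω, ξ i ω ∂μ = 0)
    (hvar : Summable fun i => variance (ξ i) μ) :
    ∀ᵐ ω ∂μ, ∃ c, Tendsto (fun n => ∑ i ∈ Finset.range n, ξ i ω) atTop (𝓝 c) := by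
  have hsm : ∀ i, StronglyMeasurable (ξ i) := fun i => (hm i).stronglyMeasurable
  set ℱ := Filtration.natural ξ hsm with hℱ
  -- The sum runs up to n inclusive because the natural filtration at n already knows ξ n.
  set S : ℕ → Ω → ℝ := fun n ω => ∑ i ∈ Finset.range (n + 1), ξ i ω with hS
  have hL1 : ∀ i, Integrable (ξ i) μ := fun i => (hL2 i).integrable one_le_two
  have hSL2 : ∀ n, MemLp (S n) 2 μ := fun n => memLp_finsetSum _ fun i _ => hL2 i
  have hSint : ∀ n, Integrable (S n) μ := fun n => (hSL2 n).integrable one_le_two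
  have hadp : StronglyAdapted ℱ S := fun n => by
    refine Finset.stronglyMeasurable_fun_sum _ fun i hi => ?_
    exact (Filtration.stronglyAdapted_natural hsm).stronglyMeasurable_le (by grind)
  have hmart : Martingale S ℱ μ := by
    refine martingale_nat hadp hSint fun n => ?_
    have h1 : S (n + 1) = S n + ξ (n + 1) := by
      ext ω
      simp [hS, Finset.sum_range_succ _ (n + 1)]
    have h2 := condExp_add (hSint n) (hL1 (n + 1)) (ℱ n)
    have h3 := hind.condExp_natural_ae_eq_of_lt hsm (Nat.lt_succ_self n)
    rw [h1]
    filter_upwards [h2, h3] with ω h2 h3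
    rw [h2, Pi.add_apply, condExp_of_stronglyMeasurable (ℱ.le n) (hadp n) (hSint n)]
    simp only [hmean] at h3
    rw [h3, add_zero]
  have hbdd : ∀ n, eLpNorm (S n) 1 μ ≤ (Real.toNNReal (1 + ∑' i, variance (ξ i) μ) : ℝ≥0) := by
    intro n
    have hmeanS : ∫ ω, S n ω ∂μ = 0 := by
      simp only [hS]
      rw [integral_finsetSum _ fun i _ => hL1 i]
      simp [hmean]
    have hvS : ∫ ω, S n ω ^ 2 ∂μ ≤ ∑' i, variance (ξ i) μ := by
      rw [← variance_of_integral_eq_zero (hSL2 n).aemeasurable hmeanS]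
      have h1 : S n = ∑ i ∈ Finset.range (n + 1), ξ i := by ext ω; simp [hS]
      rw [h1, IndepFun.variance_sum (fun i _ => hL2 i) fun i _ j _ hij => hind.indepFun hij]
      exact hvar.sum_le_tsum _ fun i _ => variance_nonneg _ _
    have h2 : ∫ ω, ‖S n ω‖ ∂μ ≤ 1 + ∑' i, variance (ξ i) μ := by
      have h3 : ∫ ω, ‖S n ω‖ ∂μ ≤ ∫ ω, (1 + S n ω ^ 2) ∂μ := by
        refine integral_mono (hSint n).norm ((integrable_const _).add (hSL2 n).integrable_sq)
          fun ω => ?_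
        rw [Real.norm_eq_abs, ← sq_abs]
        nlinarith [sq_nonneg (|S n ω| - 1), abs_nonneg (S n ω)]
      rw [integral_add (integrable_const _) (hSL2 n).integrable_sq] at h3
      simp only [integral_const, probReal_univ, smul_eq_mul, mul_one] at h3
      linarith
    rw [eLpNorm_one_eq_lintegral_enorm, ← ofReal_integral_norm_eq_lintegral_enorm (hSint n)]
    exact ENNReal.ofReal_le_ofReal h2
  filter_upwards [hmart.submartingale.exists_ae_tendsto_of_bdd hbdd] with ω ⟨c, hc⟩
  exact ⟨c, (tendsto_add_atTop_iff_nat 1).1 hc⟩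

open Set in
theorem expMeasure_moment {r : ℝ} (hr : 0 < r) (k : ℕ) :
    Integrable (fun x : ℝ => x ^ k) (expMeasure r) ∧
      ∫ x, x ^ k ∂(expMeasure r) = Real.Gamma (k + 1) / r ^ k := by
  have hm : Measurable (gammaPDF 1 r) := (measurable_gammaPDFReal 1 r).ennreal_ofReal
  have hlt : ∀ᵐ x : ℝ, gammaPDF 1 r x < ⊤ := Eventually.of_forall fun _ => ENNReal.ofReal_lt_top
  have hfun : (fun x : ℝ => (gammaPDF 1 r x).toReal • x ^ k) =ᵐ[volume]
      (Ioi (0 : ℝ)).indicator fun x => r * (x ^ ((k : ℝ) + 1 - 1) * Real.exp (-(r * x))) := by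
    filter_upwards [Measure.ae_ne volume 0] with x hx
    rcases lt_or_gt_of_ne hx with hx | hx
    · rw [gammaPDF_of_neg hx, indicator_of_notMem (by simpa using hx.le)]
      simp
    · rw [gammaPDF_of_nonneg hx.le, indicator_of_mem (by simpa using hx),
        ENNReal.toReal_ofReal (by rw [Real.Gamma_one]; positivity)]
      simp
      ring
  have hi : IntegrableOn (fun x : ℝ => x ^ ((k : ℝ) + 1 - 1) * Real.exp (-(r * x))) (Ioi 0) :=
    integrableOn_rpow_mul_exp (by positivity) hr
  rw [expMeasure, gammaMeasure]
  constructor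
  · rw [integrable_withDensity_iff_integrable_smul' hm hlt, integrable_congr hfun,
      integrable_indicator_iff measurableSet_Ioi]
    exact hi.const_mul r
  · rw [integral_withDensity_eq_integral_toReal_smul hm hlt, integral_congr_ae hfun,
      integral_indicator measurableSet_Ioi, integral_const_mul,
      Real.integral_rpow_mul_exp_neg_mul_Ioi (by positivity) hr, Real.rpow_add_one (by positivity),
      Real.rpow_natCast, one_div_pow]
    field_simp

section

variable {Ω : Type*} [MeasurableSpace Ω] {μ : Measure Ω} {β ν : ℝ} {rate : ℕ → ℝ}
  {gap : ℕ → Ω → ℝ} {X : ℕ → ℝ≥0 → Ω → ℕ} {pick : ℝ → Ω → ℕ}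

theorem ae_nonneg_of_map_eq_expMeasure {Z : Ω → ℝ} (hZ : Measurable Z) {r : ℝ}
    (h : μ.map Z = expMeasure r) : ∀ᵐ ω ∂μ, 0 ≤ Z ω := by
  have h1 : ∀ᵐ x ∂(μ.map Z), 0 ≤ x := by
    rw [h, ae_iff]
    have h2 : {x : ℝ | ¬ 0 ≤ x} = Set.Iio 0 := by ext; simp
    rw [h2, expMeasure, gammaMeasure, withDensity_apply _ measurableSet_Iio]
    exact lintegral_gammaPDF_of_nonpos le_rfl
  exact ae_of_ae_map hZ.aemeasurable h1

namespace IsGeneralizedYuleModel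

theorem ae_monotone_birthTime (h : IsGeneralizedYuleModel μ β ν rate gap X pick) :
    ∀ᵐ ω ∂μ, Monotone fun k => birthTime gap k ω := by
  have h1 : ∀ᵐ ω ∂μ, ∀ i, 0 ≤ gap i ω := ae_all_iff.2 fun i =>
    ae_nonneg_of_map_eq_expMeasure (h.gap_measurable i) (h.gap_law i)
  filter_upwards [h1] with ω hω
  refine monotone_nat_of_le_succ fun k => ?_
  simp only [birthTime, Finset.sum_range_succ]
  linarith [hω k]

/-- The centred gaps have summable variances 1/(β(i+1))², their means add up to the harmonic number
over β, and harmonic numbers minus log k converge to Euler's constant. -/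
theorem ae_tendsto_birthTime [IsProbabilityMeasure μ]
    (h : IsGeneralizedYuleModel μ β ν rate gap X pick) (hβ : 0 < β) :
    ∀ᵐ ω ∂μ, ∃ c, Tendsto (fun k : ℕ => birthTime gap k ω - Real.log k / β) atTop (𝓝 c) := by
  have hr : ∀ i : ℕ, 0 < β * (i + 1) := fun i => by positivity
  have hmom : ∀ i k : ℕ, Integrable (fun ω => gap i ω ^ k) μ ∧
      ∫ ω, gap i ω ^ k ∂μ = Real.Gamma (k + 1) / (β * (i + 1)) ^ k := by
    intro i k
    have h1 := expMeasure_moment (hr i) k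
    rw [← h.gap_law i] at h1
    have hs : AEStronglyMeasurable (fun x : ℝ => x ^ k) (μ.map (gap i)) := by fun_prop
    rw [integral_map (h.gap_measurable i).aemeasurable hs,
      integrable_map_measure hs (h.gap_measurable i).aemeasurable] at h1
    exact h1
  have hmean : ∀ i : ℕ, ∫ ω, gap i ω ∂μ = 1 / (β * (i + 1)) := fun i => by
    have := (hmom i 1).2
    simpa [Real.Gamma_two, one_add_one_eq_two] using this
  have hL2 : ∀ i, MemLp (gap i) 2 μ := fun i =>
    (memLp_two_iff_integrable_sq (h.gap_measurable i).aestronglyMeasurable).2 (hmom i 2).1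
  have hvar : ∀ i, variance (gap i) μ = 1 / (β * (i + 1)) ^ 2 := fun i => by
    have h2 := (hmom i 2).2
    have h3 : Real.Gamma ((2 : ℕ) + 1) = 2 := by
      rw [Real.Gamma_nat_eq_factorial]; norm_num [Nat.factorial]
    rw [h3] at h2
    rw [variance_eq_sub (hL2 i)]
    simp only [Pi.pow_apply]
    rw [h2, hmean]
    generalize β * ((i : ℝ) + 1) = a
    ring
  set ξ : ℕ → Ω → ℝ := fun i ω => gap i ω - 1 / (β * (i + 1)) with hξ
  have hconv := exists_ae_tendsto_sum_of_summable_variance (μ := μ) (ξ := ξ)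
    (fun i => (h.gap_measurable i).sub_const _)
    (h.gap_indep.comp (fun i x => x - 1 / (β * (i + 1))) fun i => by fun_prop)
    (fun i => (hL2 i).sub (memLp_const _))
    (fun i => by
      simp only [hξ]
      rw [integral_sub ((hL2 i).integrable one_le_two) (integrable_const _), hmean]
      simp)
    (by
      have h1 : ∀ i, variance (ξ i) μ = (β ^ 2)⁻¹ * (((i + 1 : ℕ) : ℝ) ^ 2)⁻¹ := fun i => by
        simp only [hξ]
        rw [variance_sub_const (h.gap_measurable i).aestronglyMeasurable, hvar]
        push_cast
        rw [mul_pow, one_div, mul_inv]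
      simp_rw [h1]
      exact ((summable_nat_add_iff 1).2 (Real.summable_nat_pow_inv.2 one_lt_two)).mul_left _)
  filter_upwards [hconv] with ω ⟨c, hc⟩
  refine ⟨c + Real.eulerMascheroniConstant / β,
    (hc.add (Real.tendsto_harmonic_sub_log.div_const β)).congr fun k => ?_⟩
  have h1 : ∑ i ∈ Finset.range k, (1 / (β * ((i : ℝ) + 1))) = (harmonic k : ℝ) / β := by
    rw [harmonic, Rat.cast_sum, Finset.sum_div]
    refine Finset.sum_congr rfl fun i _ => ?_
    push_cast
    field_simp
  simp only [hξ, Finset.sum_sub_distrib, h1, birthTime]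
  ring

end IsGeneralizedYuleModel

end

/-! ### Ages of the pages -/

theorem integral_floor_eq_sum (g : ℕ → ℝ) (n : ℕ) :
    ∫ y in (0 : ℝ)..n, g ⌊y⌋₊ = ∑ k ∈ Finset.range n, g k := by
  have hae : ∀ k : ℕ, ∀ᵐ y : ℝ, y ∈ Set.uIoc (k : ℝ) ((k + 1 : ℕ) : ℝ) → g k = g ⌊y⌋₊ := by
    intro k
    filter_upwards [Measure.ae_ne volume ((k + 1 : ℕ) : ℝ)] with y hy hyk
    rw [Set.uIoc_of_le (by simp)] at hyk
    rw [(Nat.floor_eq_iff (le_trans k.cast_nonneg hyk.1.le)).2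
      ⟨hyk.1.le, by exact_mod_cast lt_of_le_of_ne hyk.2 hy⟩]
  have h := intervalIntegral.sum_integral_adjacent_intervals (μ := volume)
    (f := fun y : ℝ => g ⌊y⌋₊) (a := fun k : ℕ => (k : ℝ)) (n := n) fun k _ =>
      (intervalIntegrable_const (c := g k)).congr_ae
        ((ae_restrict_iff' measurableSet_uIoc).2 (hae k))
  rw [Nat.cast_zero] at h
  rw [← h]
  refine Finset.sum_congr rfl fun k _ => ?_
  rw [← intervalIntegral.integral_congr_ae (hae k)]
  simp

/-- Rewriting the average as an integral over the fixed interval (0, 1) prepares dominated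
convergence as n grows. -/
theorem integral_floor_mul_eq_average (g : ℕ → ℝ) {n : ℕ} (hn : n ≠ 0) :
    ∫ x in (0 : ℝ)..1, g ⌊(n : ℝ) * x⌋₊ = (n : ℝ)⁻¹ * ∑ k ∈ Finset.range n, g k := by
  rw [intervalIntegral.integral_comp_mul_left (fun y => g ⌊y⌋₊) (Nat.cast_ne_zero.2 hn),
    mul_zero, mul_one, integral_floor_eq_sum, smul_eq_mul]

-- If x is uniform on (0, 1), then -log x / β is exponential of rate β; the substitution is x =
-- e^(-βs).
open Set in
theorem integral_comp_neg_log_div {β : ℝ} (hβ : 0 < β) (p : ℝ → ℝ) :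
    ∫ x in (0 : ℝ)..1, p (-Real.log x / β) = β * ∫ s in Ioi (0 : ℝ), Real.exp (-β * s) * p s := by
  have himg : (fun s : ℝ => Real.exp (-β * s)) '' Ioi 0 = Ioo 0 1 := by
    ext x
    constructor
    · rintro ⟨s, hs, rfl⟩
      exact ⟨Real.exp_pos _, Real.exp_lt_one_iff.2 (by have := mul_pos hβ hs; linarith)⟩
    · rintro ⟨h0, h1⟩
      refine ⟨-Real.log x / β, div_pos (neg_pos.2 (Real.log_neg h0 h1)) hβ, ?_⟩
      simp only
      rw [show -β * (-Real.log x / β) = Real.log x by field_simp, Real.exp_log h0]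
  have hder : ∀ s ∈ Ioi (0 : ℝ), HasDerivWithinAt (fun s : ℝ => Real.exp (-β * s))
      (Real.exp (-β * s) * -β) (Ioi 0) s := fun s _ => by
    simpa using ((hasDerivAt_id s).const_mul (-β)).exp.hasDerivWithinAt
  have hinj : InjOn (fun s : ℝ => Real.exp (-β * s)) (Ioi 0) := fun a _ b _ hab => by
    have := Real.exp_injective hab
    exact mul_left_cancel₀ (neg_ne_zero.2 hβ.ne') this
  have h := integral_image_eq_integral_abs_deriv_smul measurableSet_Ioi hder hinj
    (fun x => p (-Real.log x / β))
  rw [himg] at h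
  rw [intervalIntegral.integral_of_le zero_le_one, integral_Ioc_eq_integral_Ioo, h,
    ← integral_const_mul]
  refine setIntegral_congr_fun measurableSet_Ioi fun s _ => ?_
  simp only [Real.log_exp, smul_eq_mul]
  rw [abs_mul, abs_of_pos (Real.exp_pos _), abs_neg, abs_of_pos hβ,
    show -(-β * s) / β = s by field_simp]
  ring

section Ages

variable {T : ℕ → ℝ} {β c : ℝ}

theorem tendsto_atTop_of_sub_log (hβ : 0 < β)
    (hT : Tendsto (fun k : ℕ => T k - Real.log k / β) atTop (𝓝 c)) : Tendsto T atTop atTop := by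
  have h1 : Tendsto (fun k : ℕ => Real.log k / β) atTop atTop :=
    (Real.tendsto_log_atTop.comp tendsto_natCast_atTop_atTop).atTop_div_const hβ
  exact (hT.add_atTop h1).congr fun k => by ring

/-- By monotonicity the pages present form an initial segment. Divergence makes it finite; `ncard`
would be 0 on an infinite set. -/
theorem lt_ncard_iff_le (hmono : Monotone T) (htop : Tendsto T atTop atTop) (t : ℝ) (k : ℕ) :
    k < {k : ℕ | T k ≤ t}.ncard ↔ T k ≤ t := by
  classical
  have hex : ∃ k, t < T k := (htop.eventually_gt_atTop t).exists
  have hset : {k : ℕ | T k ≤ t} = Set.Iio (Nat.find hex) := by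
    ext k
    simp only [Set.mem_ofPred_eq, Set.mem_Iio, Nat.lt_find_iff, not_lt]
    exact ⟨fun h m hm => (hmono hm).trans h, fun h => h k le_rfl⟩
  have hcard : {k : ℕ | T k ≤ t}.ncard = Nat.find hex := by
    rw [hset, ← Finset.coe_Iio, Set.ncard_coe_finset, Nat.card_Iio]
  rw [hcard, ← Set.mem_Iio, ← hset, Set.mem_ofPred_eq]

theorem tendsto_ncard_atTop (hmono : Monotone T) (htop : Tendsto T atTop atTop) :
    Tendsto (fun t : ℝ => {k : ℕ | T k ≤ t}.ncard) atTop atTop := by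
  refine tendsto_atTop.2 fun m => ?_
  filter_upwards [eventually_ge_atTop (T m)] with t ht
  exact ((lt_ncard_iff_le hmono htop t m).2 ht).le

/-- With n ≥ 1 pages present, T (n-1) ≤ t < T n, and the shift of index costs only log((n+1)/n)/β.
-/
theorem tendsto_sub_log_ncard (hmono : Monotone T) (hβ : 0 < β)
    (hT : Tendsto (fun k : ℕ => T k - Real.log k / β) atTop (𝓝 c)) :
    Tendsto (fun t : ℝ => t - Real.log ({k : ℕ | T k ≤ t}.ncard : ℝ) / β) atTop (𝓝 c) := by
  have htop := tendsto_atTop_of_sub_log hβ hT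
  have hn := tendsto_ncard_atTop hmono htop
  have hlow : Tendsto (fun n : ℕ => T (n - 1) - Real.log n / β) atTop (𝓝 c) := by
    rw [← tendsto_add_atTop_iff_nat 1]
    have h1 : Tendsto (fun n : ℕ => (Real.log ((n + 1 : ℕ) : ℝ) - Real.log n) / β) atTop
        (𝓝 (0 / β)) := by
      refine Tendsto.div_const ?_ β
      simpa using Real.tendsto_log_nat_add_one_sub_log
    have h2 := hT.sub h1
    rw [zero_div, sub_zero] at h2
    refine h2.congr fun n => ?_
    simp only [add_tsub_cancel_right]
    ring
  refine tendsto_of_tendsto_of_tendsto_of_le_of_le' (hlow.comp hn) (hT.comp hn) ?_ ?_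
  · filter_upwards [hn.eventually_ge_atTop 1] with t ht
    have := (lt_ncard_iff_le hmono htop t ({k : ℕ | T k ≤ t}.ncard - 1)).1 (by lia)
    simp only [Function.comp]
    linarith
  · refine Eventually.of_forall fun t => ?_
    have := (lt_ncard_iff_le hmono htop t {k : ℕ | T k ≤ t}.ncard).not.1 (lt_irrefl _)
    simp only [Function.comp]
    linarith

open Set in
/-- The empirical law of the ages of the pages converges to an exponential law. -/
theorem tendsto_average_age (hmono : Monotone T) (hβ : 0 < β)
    (hT : Tendsto (fun k : ℕ => T k - Real.log k / β) atTop (𝓝 c)) {p : ℝ → ℝ}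
    (hp : Continuous p) {M : ℝ} (hM : ∀ s, |p s| ≤ M) :
    Tendsto (fun t : ℝ => (({k : ℕ | T k ≤ t}.ncard : ℝ))⁻¹ *
        ∑ k ∈ Finset.range {k : ℕ | T k ≤ t}.ncard, p (t - T k)) atTop
      (𝓝 (β * ∫ s in Ioi (0 : ℝ), Real.exp (-β * s) * p s)) := by
  have htop := tendsto_atTop_of_sub_log hβ hT
  have hn := tendsto_ncard_atTop hmono htop
  have ht := tendsto_sub_log_ncard hmono hβ hT
  set n : ℝ → ℕ := fun t => {k : ℕ | T k ≤ t}.ncard with hn_def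
  have hn' : Tendsto (fun t => (n t : ℝ)) atTop atTop := tendsto_natCast_atTop_atTop.comp hn
  rw [← integral_comp_neg_log_div hβ]
  have hDCT : Tendsto (fun t : ℝ => ∫ x in (0 : ℝ)..1, p (t - T ⌊(n t : ℝ) * x⌋₊)) atTop
      (𝓝 (∫ x in (0 : ℝ)..1, p (-Real.log x / β))) := by
    refine intervalIntegral.tendsto_integral_filter_of_dominated_convergence (fun _ => M)
      (Eventually.of_forall fun t => ?_) (Eventually.of_forall fun t =>
        Eventually.of_forall fun x _ => hM _) intervalIntegrable_const
      (Eventually.of_forall fun x hx => ?_)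
    · have h1 : Measurable fun k : ℕ => p (t - T k) := measurable_from_nat
      exact (h1.comp (Nat.measurable_floor.comp (measurable_const_mul (n t : ℝ)))).aestronglyMeasurable
    · rw [uIoc_of_le zero_le_one] at hx
      have hx0 := hx.1
      refine (hp.tendsto _).comp ?_
      have hk : Tendsto (fun t => ⌊(n t : ℝ) * x⌋₊) atTop atTop :=
        tendsto_nat_floor_atTop.comp (hn'.atTop_mul_const hx0)
      have hratio : Tendsto (fun t => (⌊(n t : ℝ) * x⌋₊ : ℝ) / n t) atTop (𝓝 x) := by
        have := (tendsto_nat_floor_mul_div_atTop (R := ℝ) hx0.le).comp hn'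
        simpa [Function.comp_def, mul_comm] using this
      have hlog := (hratio.log hx0.ne').div_const β
      -- With k = ⌊nx⌋, t - T k = (t - log n/β) - (T k - log k/β) - log(k/n)/β; both brackets tend
      -- to the same c.
      have h := (ht.sub (hT.comp hk)).sub hlog
      rw [sub_self, zero_sub, ← neg_div] at h
      refine h.congr' ?_
      filter_upwards [hn.eventually_gt_atTop 0, hk.eventually_gt_atTop 0] with t h1 h2
      simp only [Function.comp]
      rw [Real.log_div (by positivity) (by positivity)]
      ring
  refine hDCT.congr' ?_
  filter_upwards [hn.eventually_gt_atTop 0] with t h1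
  exact integral_floor_mul_eq_average (fun k => p (t - T k)) h1.ne'

end Ages

/-! ### The size of a uniformly chosen page -/

/-- Time is rounded to the next point strictly to the right on the grid of mesh 1/(j+1). This takes
countably many values, and right-continuity gives the limit. -/
theorem measurable_uncurry_of_rightContinuous {Ω : Type*} {m : MeasurableSpace Ω}
    {Y : ℝ≥0 → Ω → ℕ} (hY : ∀ t, Measurable (Y t))
    (hrc : ∀ ω t, ContinuousWithinAt (fun s => Y s ω) (Set.Ici t) t) :
    Measurable fun z : ℝ≥0 × Ω => Y z.1 z.2 := by
  refine measurable_of_tendsto_metrizable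
    (f := fun (j : ℕ) (z : ℝ≥0 × Ω) => Y ((⌊((j : ℝ≥0) + 1) * z.1⌋₊ + 1 : ℝ≥0) / ((j : ℝ≥0) + 1)) z.2)
    (fun j => ?_) (tendsto_pi_nhds.2 fun z => ?_)
  · have h1 : Measurable fun q : ℕ × Ω => Y (((q.1 : ℝ≥0) + 1) / ((j : ℝ≥0) + 1)) q.2 :=
      measurable_from_prod_countable_right fun k => hY ((k + 1) / (j + 1))
    have h2 : Measurable fun z : ℝ≥0 × Ω => (⌊((j : ℝ≥0) + 1) * z.1⌋₊, z.2) :=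
      (Nat.measurable_floor.comp (measurable_fst.const_mul _)).prodMk measurable_snd
    simpa only [Function.comp_def] using h1.comp h2
  · refine (hrc z.2 z.1).tendsto.comp (tendsto_nhdsWithin_iff.2 ⟨?_, Eventually.of_forall fun j => ?_⟩)
    · have h1 : Tendsto (fun j : ℕ => z.1 + 1 / ((j : ℝ≥0) + 1)) atTop (𝓝 (z.1 + 0)) :=
        tendsto_const_nhds.add tendsto_one_div_add_atTop_nhds_zero_nat
      rw [add_zero] at h1
      refine tendsto_of_tendsto_of_tendsto_of_le_of_le tendsto_const_nhds h1 (fun j => ?_)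
        fun j => ?_
      · simp only
        rw [le_div_iff₀ (by positivity), mul_comm]
        exact (Nat.lt_floor_add_one _).le
      · simp only
        have hj : (j : ℝ≥0) + 1 ≠ 0 := by positivity
        rw [div_le_iff₀ (by positivity), add_mul z.1, one_div_mul_cancel hj, mul_comm z.1]
        gcongr
        exact Nat.floor_le zero_le
    · rw [Set.mem_Ici, le_div_iff₀ (by positivity), mul_comm]
      exact (Nat.lt_floor_add_one _).le

theorem integral_comp_of_indepFun {Ω E F : Type*} {mΩ : MeasurableSpace Ω} {mE : MeasurableSpace E}
    {mF : MeasurableSpace F} {μ : Measure Ω} [IsProbabilityMeasure μ] {G : Ω → E} {H : Ω → F}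
    (hG : Measurable G) (hH : Measurable H) (hind : IndepFun G H μ) {φ : E → F → ℝ}
    (hφ : Measurable fun z : E × F => φ z.1 z.2) {M : ℝ} (hM : ∀ x y, |φ x y| ≤ M) :
    ∫ ω, φ (G ω) (H ω) ∂μ = ∫ ω, ∫ ω', φ (G ω) (H ω') ∂μ ∂μ := by
  have : IsProbabilityMeasure (μ.map G) := Measure.isProbabilityMeasure_map hG.aemeasurable
  have : IsProbabilityMeasure (μ.map H) := Measure.isProbabilityMeasure_map hH.aemeasurable
  have h1 := hind.map_prod_eq_prod_map_map hG.aemeasurable hH.aemeasurable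
  have h2 : ∫ ω, φ (G ω) (H ω) ∂μ = ∫ z, φ z.1 z.2 ∂(μ.map fun ω => (G ω, H ω)) :=
    (integral_map (hG.prodMk hH).aemeasurable hφ.aestronglyMeasurable).symm
  have hint : Integrable (fun z : E × F => φ z.1 z.2) ((μ.map G).prod (μ.map H)) :=
    Integrable.of_bound hφ.aestronglyMeasurable M (Eventually.of_forall fun z => hM _ _)
  rw [h2, h1, integral_prod _ hint, integral_map hG.aemeasurable
    hφ.stronglyMeasurable.integral_prod_right'.aestronglyMeasurable]
  congr 1 with ω
  exact integral_map hH.aemeasurable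
    (hφ.comp measurable_prodMk_left).aestronglyMeasurable

-- The process is read at a time depending on G alone, so G can be frozen and the indicator replaced
-- by its mean.
open Classical in
theorem integral_indicator_mul_of_indepFun {Ω E F : Type*} {mΩ : MeasurableSpace Ω}
    {mE : MeasurableSpace E} {mF : MeasurableSpace F} {μ : Measure Ω} [IsProbabilityMeasure μ]
    {G : Ω → E} {H : Ω → F} (hG : Measurable G) (hH : Measurable H) (hind : IndepFun G H μ)
    {Y : ℝ≥0 → F → ℕ} (hY : ∀ t, Measurable (Y t))
    (hrc : ∀ y t, ContinuousWithinAt (fun s => Y s y) (Set.Ici t) t) {U : E → ℝ≥0}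
    (hU : Measurable U) {w : E → ℝ} (hw : Measurable w) (hw0 : ∀ x, 0 ≤ w x) (hw1 : ∀ x, w x ≤ 1)
    (n : ℕ) :
    ∫ ω, (if Y (U (G ω)) (H ω) = n then 1 else 0) * w (G ω) ∂μ
      = ∫ ω, μ.real {ω' | Y (U (G ω)) (H ω') = n} * w (G ω) ∂μ := by
  have hj := measurable_uncurry_of_rightContinuous hY hrc
  have hφm : Measurable fun z : E × F => (if Y (U z.1) z.2 = n then 1 else 0) * w z.1 :=
    (Measurable.ite ((hj.comp ((hU.comp measurable_fst).prodMk measurable_snd))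
      (measurableSet_singleton n)) measurable_const measurable_const).mul (hw.comp measurable_fst)
  rw [integral_comp_of_indepFun hG hH hind
    (φ := fun x y => (if Y (U x) y = n then 1 else 0) * w x) hφm (M := 1) fun x y => by
      split_ifs
      · rw [one_mul, abs_of_nonneg (hw0 x)]; exact hw1 x
      · simp]
  refine integral_congr_ae (Eventually.of_forall fun ω => ?_)
  simp only
  rw [integral_mul_const]
  congr 1
  have hs : MeasurableSet {ω' | Y (U (G ω)) (H ω') = n} :=
    ((hY _).comp hH) (measurableSet_singleton n)
  rw [← integral_indicator_one hs]
  exact integral_congr_ae (Eventually.of_forall fun ω' => by simp [Set.indicator_apply])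

/-- The conditional probability, given the creation times, of choosing page `k` at time `t`. -/
noncomputable def pageWeight {Ω : Type*} (gap : ℕ → Ω → ℝ) (k : ℕ) (t : ℝ) (ω : Ω) : ℝ :=
  if birthTime gap k ω ≤ t then ((pageCount gap t ω : ℝ))⁻¹ else 0

section Weight

variable {Ω : Type*} {m : MeasurableSpace Ω} {gap : ℕ → Ω → ℝ}

theorem measurable_birthTime (hgap : ∀ i, Measurable (gap i)) (k : ℕ) :
    Measurable (birthTime gap k) :=
  Finset.measurable_fun_sum _ fun i _ => hgap i

theorem measurable_pageCount (hgap : ∀ i, Measurable (gap i)) (t : ℝ) :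
    Measurable (pageCount gap t) := by
  classical
  have hset : ∀ k, MeasurableSet {ω | birthTime gap k ω ≤ t} := fun k =>
    measurableSet_le (measurable_birthTime hgap k) measurable_const
  -- A countable sum of indicators; on an infinite set both sides are 0, as `toReal` sends ⊤ to 0.
  have h1 : pageCount gap t
      = fun ω => ⌊(∑' k, if birthTime gap k ω ≤ t then (1 : ENNReal) else 0).toReal⌋₊ := by
    ext ω
    have h2 : (∑' k, if birthTime gap k ω ≤ t then (1 : ENNReal) else 0)
        = ({k : ℕ | birthTime gap k ω ≤ t}.encard : ENNReal) := by
      rw [← ENNReal.tsum_set_one, tsum_subtype _ fun _ => (1 : ENNReal)]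
      rfl
    rw [h2, pageCount, Set.ncard_def]
    rcases eq_or_ne {k : ℕ | birthTime gap k ω ≤ t}.encard ⊤ with h3 | h3
    · simp [h3]
    · lift {k : ℕ | birthTime gap k ω ≤ t}.encard to ℕ using h3 with q
      simp
  rw [h1]
  exact Nat.measurable_floor.comp (Measurable.tsum fun k =>
    Measurable.ite (hset k) measurable_const measurable_const).ennreal_toReal

theorem measurable_pageWeight (hgap : ∀ i, Measurable (gap i)) (k : ℕ) (t : ℝ) :
    Measurable (pageWeight gap k t) :=
  Measurable.ite (measurableSet_le (measurable_birthTime hgap k) measurable_const)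
    ((measurable_from_nat (f := fun m : ℕ => (m : ℝ))).comp (measurable_pageCount hgap t)).inv
    measurable_const

theorem pageWeight_nonneg (k : ℕ) (t : ℝ) (ω : Ω) : 0 ≤ pageWeight gap k t ω := by
  unfold pageWeight
  split_ifs
  · positivity
  · exact le_rfl

theorem pageWeight_le_one (k : ℕ) (t : ℝ) (ω : Ω) : pageWeight gap k t ω ≤ 1 := by
  unfold pageWeight
  split_ifs
  · exact Nat.cast_inv_le_one _
  · exact zero_le_one

end Weight

/-- Only the fibres of Z need to be measurable, since they are summed under the restriction of μ to
S. -/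
theorem hasSum_measureReal_inter_fiber {Ω : Type*} {m : MeasurableSpace Ω} {μ : Measure Ω}
    [IsFiniteMeasure μ] {Z : Ω → ℕ} (hZ : Measurable Z) (S : Set Ω) :
    HasSum (fun k => μ.real (S ∩ {ω | Z ω = k})) (μ.real S) := by
  have h1 : μ S = ∑' k, μ (S ∩ {ω | Z ω = k}) := by
    have h2 := measure_iUnion (μ := μ.restrict S) (f := fun k => {ω | Z ω = k})
      (fun i j hij => Set.disjoint_left.2 fun ω hi hj => hij (hi.symm.trans hj))
      (fun k => hZ (measurableSet_singleton k))
    have h3 : ⋃ k, {ω | Z ω = k} = Set.univ := by ext; simp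
    rw [h3, Measure.restrict_apply_univ] at h2
    rw [h2]
    congr 1 with k
    rw [Measure.restrict_apply (show MeasurableSet {ω | Z ω = k} from hZ (measurableSet_singleton k)),
      Set.inter_comm]
  have h4 := ENNReal.hasSum_toReal (f := fun k => μ (S ∩ {ω | Z ω = k}))
    (by rw [← h1]; exact measure_ne_top _ _)
  rw [← ENNReal.tsum_toReal_eq fun k => measure_ne_top _ _, ← h1] at h4
  exact h4

namespace IsGeneralizedYuleModel

variable {Ω : Type*} {m0 : MeasurableSpace Ω} {μ : Measure Ω} [IsProbabilityMeasure μ]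
  {β ν : ℝ} {rate : ℕ → ℝ} {gap : ℕ → Ω → ℝ} {X : ℕ → ℝ≥0 → Ω → ℕ} {pick : ℝ → Ω → ℕ}

omit [IsProbabilityMeasure μ] in
theorem networkSigma_le (h : IsGeneralizedYuleModel μ β ν rate gap X pick) :
    networkSigma gap X ≤ m0 := by
  refine Measurable.comap_le (Measurable.prodMk (measurable_pi_lambda _ h.gap_measurable)
    (measurable_pi_lambda _ fun i => measurable_pi_lambda _ fun s => (h.inlinks i).measurable s))

-- The law of the chosen page is prescribed only on events of the network, so measurability is
-- needed in this smaller σ-algebra.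
omit [IsProbabilityMeasure μ] in
theorem measurableSet_size_eq (h : IsGeneralizedYuleModel μ β ν rate gap X pick) (t : ℝ)
    (k n : ℕ) :
    MeasurableSet[networkSigma gap X]
      {ω | X k (t - birthTime gap k ω).toNNReal ω = n} := by
  have hΦ := comap_measurable (m := inferInstance)
    (fun ω => ((fun i => gap i ω, fun i s => X i s ω) : (ℕ → ℝ) × (ℕ → ℝ≥0 → ℕ)))
  have hgap : ∀ i, Measurable[networkSigma gap X] (gap i) := fun i =>
    (measurable_pi_apply i).comp (measurable_fst.comp hΦ)
  have hX : ∀ i s, Measurable[networkSigma gap X] (X i s) := fun i s =>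
    (measurable_pi_apply s).comp ((measurable_pi_apply i).comp (measurable_snd.comp hΦ))
  have hj := measurable_uncurry_of_rightContinuous (m := networkSigma gap X) (hX k)
    (h.inlinks k).rightCont
  have hpair : @Measurable _ _ (networkSigma gap X) (@Prod.instMeasurableSpace _ _ _ (networkSigma gap X))
      fun ω => ((t - birthTime gap k ω).toNNReal, ω) :=
    Measurable.prodMk ((measurable_const.sub (measurable_birthTime hgap k)).real_toNNReal)
      measurable_id
  exact (hj.comp hpair) (measurableSet_singleton n)

/-- Independence of the creation times and the in-link processes, in integrated form. -/
theorem setIntegral_pageWeight_eq (h : IsGeneralizedYuleModel μ β ν rate gap X pick) (t : ℝ)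
    (k n : ℕ) :
    ∫ ω in {ω | X k (t - birthTime gap k ω).toNNReal ω = n}, pageWeight gap k t ω ∂μ
      = ∫ ω, stateProb μ (X k) n (t - birthTime gap k ω) * pageWeight gap k t ω ∂μ := by
  classical
  have hX : Measurable fun (ω : Ω) i s => X i s ω :=
    measurable_pi_lambda _ fun i => measurable_pi_lambda _ fun s => (h.inlinks i).measurable s
  have hG : Measurable fun ω i => gap i ω := measurable_pi_lambda _ h.gap_measurable
  have hA : MeasurableSet {ω | X k (t - birthTime gap k ω).toNNReal ω = n} :=
    h.networkSigma_le _ (h.measurableSet_size_eq t k n)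
  -- Arbitrary elements of the path space need not be right-continuous. So the second factor is Ω
  -- itself with the σ-algebra of the in-links, and the map into it is the identity.
  have hΨ := comap_measurable (m := inferInstance) (fun ω => fun i s => X i s ω)
  have hind : @IndepFun Ω (ℕ → ℝ) Ω m0 _
      (MeasurableSpace.comap (fun ω => fun i s => X i s ω) inferInstance)
      (fun ω i => gap i ω) id μ := by
    refine (@IndepFun_iff_Indep Ω (ℕ → ℝ) Ω m0 _
      (MeasurableSpace.comap (fun ω => fun i s => X i s ω) inferInstance) _ _ μ).2 ?_
    rw [MeasurableSpace.comap_id]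
    exact (IndepFun_iff_Indep _ _ _).1 h.gap_inlinks_indep
  have hcm : ∀ i, Measurable fun g : ℕ → ℝ => g i := fun i => measurable_pi_apply i
  have key := @integral_indicator_mul_of_indepFun Ω (ℕ → ℝ) Ω m0 _
    (MeasurableSpace.comap (fun ω => fun i s => X i s ω) inferInstance) μ _
    (fun ω i => gap i ω) id hG (measurable_id'' hX.comap_le) hind (X k)
    (fun s => (measurable_pi_apply s).comp ((measurable_pi_apply k).comp hΨ))
    (h.inlinks k).rightCont (fun g => (t - birthTime (fun i (g : ℕ → ℝ) => g i) k g).toNNReal)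
    (measurable_const.sub (measurable_birthTime hcm k)).real_toNNReal
    (pageWeight (fun i (g : ℕ → ℝ) => g i) k t) (measurable_pageWeight hcm k t)
    (pageWeight_nonneg k t) (pageWeight_le_one k t) n
  rw [← integral_indicator hA]
  refine Eq.trans (integral_congr_ae (Eventually.of_forall fun ω => ?_)) key
  change Set.indicator _ _ ω = (if X k (t - birthTime gap k ω).toNNReal ω = n then 1 else 0)
    * pageWeight gap k t ω
  by_cases hω : X k (t - birthTime gap k ω).toNNReal ω = n <;> simp [hω]

theorem hasSum_measureReal_pageSize (h : IsGeneralizedYuleModel μ β ν rate gap X pick) {t : ℝ}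
    (ht : 0 ≤ t) (n : ℕ) :
    HasSum (fun k => ∫ ω, stateProb μ (X k) n (t - birthTime gap k ω) * pageWeight gap k t ω ∂μ)
      (μ.real {ω | pageSize gap X pick t ω = n}) := by
  refine (hasSum_measureReal_inter_fiber (h.pick_measurable t) _).congr_fun fun k => ?_
  rw [← h.setIntegral_pageWeight_eq, show ({ω | pageSize gap X pick t ω = n} ∩ {ω | pick t ω = k})
    = {ω | X k (t - birthTime gap k ω).toNNReal ω = n} ∩ {ω | pick t ω = k} from ?_]
  · exact (h.pick_uniform t ht k _ (h.measurableSet_size_eq t k n)).symm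
  · ext ω
    simp only [Set.mem_inter_iff, Set.mem_ofPred_eq, pageSize]
    constructor <;> rintro ⟨h1, rfl⟩ <;> exact ⟨h1, rfl⟩

/-- The terms are the probabilities of choosing page k. The series dominates the exchange of sum and
expectation. -/
theorem summable_integral_pageWeight (h : IsGeneralizedYuleModel μ β ν rate gap X pick) {t : ℝ}
    (ht : 0 ≤ t) : Summable fun k => ∫ ω, pageWeight gap k t ω ∂μ := by
  refine (hasSum_measureReal_inter_fiber (μ := μ) (h.pick_measurable t) Set.univ).summable.congr
    fun k => ?_
  rw [h.pick_uniform t ht k _ MeasurableSet.univ, Measure.restrict_univ]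
  rfl

/-- The law of the size of a random page as an average over the ages of the pages. -/
theorem measureReal_pageSize_eq (h : IsGeneralizedYuleModel μ β ν rate gap X pick) (hβ : 0 < β)
    {n : ℕ} {p : ℝ → ℝ} (hp : Continuous p) (hX : ∀ k, stateProb μ (X k) n = p) {t : ℝ}
    (ht : 0 ≤ t) :
    μ.real {ω | pageSize gap X pick t ω = n}
      = ∫ ω, (pageCount gap t ω : ℝ)⁻¹ *
        ∑ k ∈ Finset.range (pageCount gap t ω), p (t - birthTime gap k ω) ∂μ := by
  have hp1 : ∀ s, |p s| ≤ 1 := fun s => by rw [← hX 0]; exact abs_stateProb_le n s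
  have hwm := fun k => measurable_pageWeight h.gap_measurable k t
  have hwi : ∀ k, Integrable (pageWeight gap k t) μ := fun k =>
    Integrable.of_bound (hwm k).aestronglyMeasurable 1 (Eventually.of_forall fun ω => by
      rw [Real.norm_of_nonneg (pageWeight_nonneg k t ω)]; exact pageWeight_le_one k t ω)
  have hFm : ∀ k, AEStronglyMeasurable
      (fun ω => p (t - birthTime gap k ω) * pageWeight gap k t ω) μ := fun k =>
    ((hp.measurable.comp (measurable_const.sub (measurable_birthTime h.gap_measurable k))).mul
      (hwm k)).aestronglyMeasurable
  have hle : ∀ k ω, ‖p (t - birthTime gap k ω) * pageWeight gap k t ω‖ ≤ pageWeight gap k t ω := by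
    intro k ω
    rw [norm_mul, Real.norm_of_nonneg (pageWeight_nonneg k t ω)]
    exact mul_le_of_le_one_left (pageWeight_nonneg k t ω) (hp1 _)
  have hFi : ∀ k, Integrable (fun ω => p (t - birthTime gap k ω) * pageWeight gap k t ω) μ :=
    fun k => (hwi k).mono' (hFm k) (Eventually.of_forall (hle k))
  have h1 := h.hasSum_measureReal_pageSize ht n
  simp only [hX] at h1
  have h2 := hasSum_integral_of_summable_integral_norm hFi
    (Summable.of_nonneg_of_le (fun k => integral_nonneg fun ω => norm_nonneg _)
      (fun k => integral_mono (hFi k).norm (hwi k) (hle k)) (h.summable_integral_pageWeight ht))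
  rw [h1.unique h2]
  refine integral_congr_ae ?_
  filter_upwards [h.ae_monotone_birthTime, h.ae_tendsto_birthTime hβ] with ω hmono ⟨c, hc⟩
  have hiff := lt_ncard_iff_le hmono (tendsto_atTop_of_sub_log hβ hc) t
  rw [tsum_eq_sum (s := Finset.range (pageCount gap t ω)), Finset.mul_sum]
  · refine Finset.sum_congr rfl fun k hk => ?_
    rw [pageWeight, if_pos ((hiff k).1 (Finset.mem_range.1 hk)), mul_comm]
  · intro k hk
    rw [pageWeight, if_neg fun hk' => hk (Finset.mem_range.2 ((hiff k).2 hk')), mul_zero]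

/-- The averages are bounded by 1 and converge almost surely to a nonrandom limit, so their
expectations converge. -/
theorem tendsto_measureReal_pageSize (h : IsGeneralizedYuleModel μ β ν rate gap X pick)
    (hβ : 0 < β) {n : ℕ} {p : ℝ → ℝ} (hp : Continuous p) (hX : ∀ k, stateProb μ (X k) n = p) :
    Tendsto (fun t : ℝ => μ.real {ω | pageSize gap X pick t ω = n}) atTop
      (𝓝 (β * ∫ s in Set.Ioi (0 : ℝ), Real.exp (-β * s) * p s)) := by
  have hp1 : ∀ s, |p s| ≤ 1 := fun s => by rw [← hX 0]; exact abs_stateProb_le n s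
  have hev : (fun t : ℝ => ∫ ω, (pageCount gap t ω : ℝ)⁻¹ *
      ∑ k ∈ Finset.range (pageCount gap t ω), p (t - birthTime gap k ω) ∂μ) =ᶠ[atTop]
      fun t : ℝ => μ.real {ω | pageSize gap X pick t ω = n} := by
    filter_upwards [eventually_ge_atTop 0] with t ht
    exact (h.measureReal_pageSize_eq hβ hp hX ht).symm
  refine Tendsto.congr' hev ?_
  have hlim : β * ∫ s in Set.Ioi (0 : ℝ), Real.exp (-β * s) * p s
      = ∫ _, (β * ∫ s in Set.Ioi (0 : ℝ), Real.exp (-β * s) * p s) ∂μ := by simp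
  rw [hlim]
  refine tendsto_integral_filter_of_dominated_convergence (fun _ => 1)
    (Eventually.of_forall fun t => ?_) (Eventually.of_forall fun t => Eventually.of_forall
      fun ω => ?_) (integrable_const _) ?_
  · have h1 : Measurable fun q : ℕ × Ω =>
        (q.1 : ℝ)⁻¹ * ∑ k ∈ Finset.range q.1, p (t - birthTime gap k q.2) :=
      measurable_from_prod_countable_right fun m => by
        change Measurable fun ω =>
          (m : ℝ)⁻¹ * ∑ k ∈ Finset.range m, p (t - birthTime gap k ω)
        exact (Finset.measurable_fun_sum _ fun k _ => hp.measurable.comp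
          (measurable_const.fun_sub (measurable_birthTime h.gap_measurable k))).const_mul _
    exact (h1.comp ((measurable_pageCount h.gap_measurable t).prodMk
      measurable_id)).aestronglyMeasurable
  · rw [norm_mul, norm_inv, RCLike.norm_natCast]
    refine inv_mul_le_one_of_le₀ ((norm_sum_le _ _).trans ?_) (Nat.cast_nonneg _)
    refine (Finset.sum_le_sum fun k _ => hp1 _).trans ?_
    simp
  · filter_upwards [h.ae_monotone_birthTime, h.ae_tendsto_birthTime hβ] with ω hmono ⟨c, hc⟩
    exact tendsto_average_age hmono hβ hc hp hp1

end IsGeneralizedYuleModel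

/-! ### Special and exceptional values of ρ, and assembly -/

/-- Here N² + 4(N+1) = (N+2)², so b = N/2 + 1 and every Gamma argument is a positive integer. -/
theorem closedForm₂_inv_succ {N n : ℕ} (hN : 1 ≤ N) (hn : 1 ≤ n) (hnN : n ≤ N) :
    closedForm₂ N (1 / ((N : ℝ) + 1)) n = (1 + 1 / (N : ℝ)) * (1 / ((n : ℝ) ^ 2 + n)) := by
  have hN0 : (0 : ℝ) < N := by exact_mod_cast hN
  have hn0 : (0 : ℝ) < n := by exact_mod_cast hn
  have hnN' : (n : ℝ) ≤ N := by exact_mod_cast hnN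
  have hs : √((N : ℝ) ^ 2 + 4 / (1 / ((N : ℝ) + 1))) = N + 2 := by
    rw [Real.sqrt_eq_iff_eq_sq (by positivity) (by positivity)]
    field_simp
    ring
  unfold closedForm₂
  rw [hs, show (1 / 2 : ℝ) * (N + 2) + 1 - N / 2 = 2 by ring,
    show (1 / 2 : ℝ) * (N + 2) + N / 2 - n = N - n + 1 by ring,
    show (1 / 2 : ℝ) * (N + 2) + N / 2 = N + 1 by ring,
    show (2 : ℝ) + n = n + 1 + 1 by ring, Real.Gamma_two, Real.Gamma_add_one (s := (n : ℝ) + 1)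
    (by positivity), Real.Gamma_add_one hn0.ne', Real.Gamma_add_one hN0.ne']
  have h1 : Real.Gamma n ≠ 0 := (Real.Gamma_pos_of_pos hn0).ne'
  have h2 : Real.Gamma N ≠ 0 := (Real.Gamma_pos_of_pos hN0).ne'
  have h3 : Real.Gamma ((N : ℝ) - n + 1) ≠ 0 := (Real.Gamma_pos_of_pos (by linarith)).ne'
  field_simp

/-- The neighbourhood is punctured because `Real.Gamma` is 0 at its poles, which gives the first
form the value 0 at an exceptional ρ. -/
theorem tendsto_closedForm₁ {N n : ℕ} {ρ : ℝ} (hρ : 0 < ρ) (hn : n ≤ N) :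
    Tendsto (fun r : ℝ => closedForm₁ N r n) (𝓝[≠] ρ) (𝓝 (closedForm₂ N ρ n)) := by
  rw [closedForm₂_eq_limitMass hρ hn]
  refine ((tendsto_limitMass hρ hn).mono_left nhdsWithin_le_nhds).congr' ?_
  have hpos : ∀ᶠ r in 𝓝[≠] ρ, 0 < r := nhdsWithin_le_nhds (lt_mem_nhds hρ)
  filter_upwards [hpos, eventually_nonexceptional (N := N) hρ] with r hr h
  exact (closedForm₁_eq_limitMass hr h).symm

theorem IsGeneralizedYuleModel.tendsto_closedForm₂ {Ω : Type*} [MeasurableSpace Ω] {μ : Measure Ω}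
    [IsProbabilityMeasure μ] {β ν lam : ℝ} {N : ℕ} {gap : ℕ → Ω → ℝ} {X : ℕ → ℝ≥0 → Ω → ℕ}
    {pick : ℝ → Ω → ℕ} (h : IsGeneralizedYuleModel μ β ν (saturatingRate lam N) gap X pick)
    (hβ : 0 < β) (hν₀ : 0 < ν) (hν₁ : ν ≤ 1) (hlam : 0 < lam) {n : ℕ} (hn : 1 ≤ n) (hnN : n ≤ N) :
    Tendsto (fun t : ℝ => μ.real {ω | pageSize gap X pick t ω = n}) atTop
      (𝓝 (closedForm₂ N (lam / β ^ ν) n)) := by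
  rw [closedForm₂_eq_limitMass (by positivity) hnN,
    ← (h.inlinks 0).mul_laplace_stateProb_eq_limitMass hν₀ hν₁ hβ hlam hn hnN]
  exact h.tendsto_measureReal_pageSize hβ ((h.inlinks 0).continuous_stateProb n) fun k =>
    (h.inlinks k).stateProb_unique (h.inlinks 0) hν₀ hν₁ n

end YuleNetwork

theorem mainTheorem5 {Ω : Type*} [MeasurableSpace Ω] (μ : Measure Ω) [IsProbabilityMeasure μ]
    (β ν lam ρ : ℝ) (N : ℕ) (hβ : 0 < β) (hν₀ : 0 < ν) (hν₁ : ν ≤ 1) (hlam : 0 < lam)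
    (hN : 1 ≤ N) (hρ : ρ = lam / β ^ ν)
    (gap : ℕ → Ω → ℝ) (X : ℕ → ℝ≥0 → Ω → ℕ) (pick : ℝ → Ω → ℕ)
    (hmodel : YuleNetwork.IsGeneralizedYuleModel μ β ν (YuleNetwork.saturatingRate lam N)
      gap X pick) :
    -- the limiting probability mass function, in the form with positive Gamma arguments
    (∀ n : ℕ, 1 ≤ n → n ≤ N →
      Tendsto (fun t : ℝ => μ.real {ω | YuleNetwork.pageSize gap X pick t ω = n}) atTop
        (𝓝 (YuleNetwork.closedForm₂ N ρ n))) ∧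
    -- no mass is lost in the limit
    (∑ n ∈ Finset.Icc 1 N, YuleNetwork.closedForm₂ N ρ n = 1) ∧
    -- the first form of the mass function, when its Gamma factors are not at a pole
    ((∀ m : ℕ, 1 - (N : ℝ) / 2 - (1 / 2) * √((N : ℝ) ^ 2 + 4 / ρ) ≠ -(m : ℝ)) →
      ∀ n : ℕ, 1 ≤ n → n ≤ N →
        Tendsto (fun t : ℝ => μ.real {ω | YuleNetwork.pageSize gap X pick t ω = n}) atTop
          (𝓝 (YuleNetwork.closedForm₁ N ρ n))) ∧
    -- at the exceptional values of `ρ` the first form is understood by continuity in `ρ`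
    (∀ n : ℕ, 1 ≤ n → n ≤ N →
      Tendsto (fun r : ℝ => YuleNetwork.closedForm₁ N r n) (𝓝[≠] ρ)
        (𝓝 (YuleNetwork.closedForm₂ N ρ n))) ∧
    -- the special case `ρ = 1 / (N + 1)`
    (ρ = 1 / ((N : ℝ) + 1) → ∀ n : ℕ, 1 ≤ n → n ≤ N →
      YuleNetwork.closedForm₂ N ρ n = (1 + 1 / (N : ℝ)) * (1 / ((n : ℝ) ^ 2 + n)) ∧
      Tendsto (fun t : ℝ => μ.real {ω | YuleNetwork.pageSize gap X pick t ω = n}) atTop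
        (𝓝 ((1 + 1 / (N : ℝ)) * (1 / ((n : ℝ) ^ 2 + n))))) := by
  have hρ0 : 0 < ρ := by rw [hρ]; positivity
  have hlim : ∀ n : ℕ, 1 ≤ n → n ≤ N →
      Tendsto (fun t : ℝ => μ.real {ω | YuleNetwork.pageSize gap X pick t ω = n}) atTop
        (𝓝 (YuleNetwork.closedForm₂ N ρ n)) := fun n hn hnN => by
    rw [hρ]
    exact hmodel.tendsto_closedForm₂ hβ hν₀ hν₁ hlam hn hnN
  refine ⟨hlim, ?_, fun hne n hn hnN => ?_, fun n _ hnN =>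
    YuleNetwork.tendsto_closedForm₁ hρ0 hnN, fun hspec n hn hnN => ?_⟩
  · rw [← YuleNetwork.sum_limitMass hρ0 hN]
    exact Finset.sum_congr rfl fun n hn =>
      YuleNetwork.closedForm₂_eq_limitMass hρ0 (Finset.mem_Icc.1 hn).2
  · rw [YuleNetwork.closedForm₁_eq_limitMass hρ0 hne,
      ← YuleNetwork.closedForm₂_eq_limitMass hρ0 hnN]
    exact hlim n hn hnN
  · have h := YuleNetwork.closedForm₂_inv_succ hN hn hnN
    rw [← hspec] at h
    exact ⟨h, h ▸ hlim n hn hnN⟩
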